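/- Let $k$ be an algebraically closed field, let $X$ be a smooth projective (integral) variety over $k$, and let $L$ be a line bundle on $X$ such that $L^{-1}$ is ample. Let $E_1,\ldots,E_n$ ($n\ge 1$) be line bundles on $X$ which generate a simple spiral with respect to $L$. That is: $\operatorname{End}(E_i)=k$ for $1\le i\le n$; $\operatorname{Ext}^m_X(E_i,E_j)=0$ for all $m$ if $1\le j<i\le n$, and for all $m\ne 0$ and all $1\le i,j\le n$; every nonzero object $K$ of the derived category of coherent sheaves on $X$ has a nonzero morphism $E_i\to K[m]$ for some $1\le i\le n$ and some $m\in\mathbb Z$; and, if $E_i$ is defined for all $i\in\mathbb Z$ by $E_{i-n}\cong E_i\otimes L$, then $\operatorname{Ext}^m_X(E_i,E_j)=0$ for all integers $i\le j$ and all $m\neq 0$. Let $\pi:V\to X$ be the total space of $L$, and let $V_0=\operatorname{Spec}\Gamma(V,\mathcal O_V)$ be the affine cone obtained from $V$ by collapsing the zero section. Let $\mathbf Q=(Q,I)$ be a quiver with nodes $1,\ldots,n$ and an admissible ideal $I$ of relations, whose path algebra $P(Q)/I$ is identified with $\operatorname{End}_V(\bigoplus_{i}\pi^*E_i)^{\mathrm{op}}$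 in such a way that the trivial path at $i$ corresponds to the idempotent of $\pi^*E_i$ (for example the Bondal quiver of $\pi^*E_1,\ldots,\pi^*E_n$). Let $B$ be the affine coordinate ring of the scheme of representations of $\mathbf Q$ with the one-dimensional space $k$ at each node, let $G=\prod_{i=1}^n\mathrm{GL}(1)/\mathbb G_m^{\mathrm{diag}}$ act on it by change of bases, and let $M_0=\operatorname{Spec}B^G$. The tautological family on $V$, whose representation at a point $p$ has the dual of the fibre of $\pi^*E_i$ at $p$ at the node $i$, pulls back the functions in $B^G$ to functions on $V$; this is a well-defined ring homomorphism $B^G\to\Gamma(V,\mathcal O_V)$. Let $\varphi_0:V_0\to M_0$ be the corresponding morphism. Then there is an irreducible component $Z$ of $M_0$ such that $\varphi_0$ is an isomorphism of $V_0$ onto $Z$ with its canonical reduced closed subscheme structure. In particular, if $M_0$ is reduced, then $\varphi_0$ is an isomorphism of $V_0$ onto the irreducible component $Z$ with its scheme structure as a component of $M_0$ (the scheme-theoretic closure in $M_0$ of the complement of the other components). -/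

import Mathlib

open AlgebraicGeometry CategoryTheory TopologicalSpace

universe u

noncomputable section

namespace BondalSpiral

section SchemeModules

attribute [local instance] MvPolynomial.gradedAlgebra

variable {X Y : Scheme.{u}}

/-- The structure sheaf of a scheme, as a sheaf of modules over itself. -/
def structureSheaf (X : Scheme.{u}) : X.Modules :=
  SheafOfModules.unit X.ringCatSheaf

/-- The tensor product of two sheaves of modules: the sheafification of the
presheaf `U ↦ M(U) ⊗ N(U)`. -/
def tensor (M N : X.Modules) : X.Modules :=
  (PresheafOfModules.sheafification (𝟙 X.ringCatSheaf.obj)).obj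
    (PresheafOfModules.Monoidal.tensorObj (R := X.presheaf) M.val N.val)

/-- The tensor powers of a sheaf of modules. -/
def tensorPow (M : X.Modules) : ℕ → X.Modules
  | 0 => structureSheaf X
  | d + 1 => tensor (tensorPow M d) M

/-- A line bundle is a sheaf of modules which is locally isomorphic to the structure sheaf. -/
def IsLineBundle (M : X.Modules) : Prop :=
  ∀ x : X, ∃ U : X.Opens, x ∈ U ∧ Nonempty (M.restrict U.ι ≅ structureSheaf U)

/-- The locus `X_s` where a section `s` of `M` generates `M`: the largest open set on which
`s : 𝒪 ⟶ M` is an isomorphism (when `M` is a line bundle, the non-vanishing locus of `s`). -/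
def generatingLocus {M : X.Modules} (s : structureSheaf X ⟶ M) : X.Opens :=
  sSup {U : X.Opens | IsIso ((Scheme.Modules.restrictFunctor U.ι).map s)}

/-- Ampleness of a line bundle: `X` is quasi-compact and the affine open sets of the form `X_s`,
with `s` a section of a positive tensor power of `M`, cover `X`. -/
def IsAmple (M : X.Modules) : Prop :=
  IsLineBundle M ∧ CompactSpace X ∧
    ∀ x : X, ∃ d : ℕ, 0 < d ∧ ∃ s : structureSheaf X ⟶ tensorPow M d,
      x ∈ generatingLocus s ∧ IsAffineOpen (generatingLocus s)

/-- `L` is a line bundle whose inverse is ample. -/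
def IsAntiAmple (L : X.Modules) : Prop :=
  IsLineBundle L ∧ ∃ L' : X.Modules, Nonempty (tensor L L' ≅ structureSheaf X) ∧ IsAmple L'

/-- The pullback of a global section along a morphism of schemes. -/
def pullbackSection (g : Y ⟶ X) {M : X.Modules} (m : Γ(M, ⊤)) :
    Γ((Scheme.Modules.pullback g).obj M, ⊤) :=
  ((Scheme.Modules.pullbackPushforwardAdjunction g).unit.app M).app ⊤ m

/-- Let `π : V ⟶ X` be a morphism and `s` a global section of `π^* L`. They form
the total space of the line bundle `L` if they represent the functor that takes `T` to the set of
pairs of a morphism `f : T ⟶ X` and a global section of `f^* L`: every such pair is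
`(g ≫ π, g^* s)` for exactly one morphism `g : T ⟶ V`. -/
def IsTotalSpace {V : Scheme.{u}} (π : V ⟶ X) (L : X.Modules)
    (s : Γ((Scheme.Modules.pullback π).obj L, ⊤)) : Prop :=
  ∀ T : Scheme.{u}, Function.Bijective
    (fun g : T ⟶ V =>
      (⟨g ≫ π, ((Scheme.Modules.pullbackComp g π).hom.app L).app ⊤ (pullbackSection g s)⟩ :
        Σ f : T ⟶ X, Γ((Scheme.Modules.pullback f).obj L, ⊤)))

/-- Restriction of global functions to an open set. -/
def restrictFunctions (U : X.Opens) : Γ(X, ⊤) →+* Γ(X, U) :=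
  (X.presheaf.map (homOfLE le_top : U ⟶ ⊤).op).hom

/-- Multiplication of a morphism of sheaves of modules by a global function. -/
def smulHom {M N : X.Modules} (r : Γ(X, ⊤)) (φ : M ⟶ N) : M ⟶ N :=
  Scheme.Modules.fullyFaithfulToPresheafOfModules.preimage (
    { app := fun U => ModuleCat.ofHom
        { toFun := fun m => (restrictFunctions U.unop r • φ.app U.unop m : Γ(N, U.unop))
          map_add' := fun m m' => by
            refine (congrArg _ (map_add (φ.app U.unop).hom m m')).trans ?_
            exact smul_add (restrictFunctions U.unop r)
              (φ.app U.unop m : Γ(N, U.unop)) (φ.app U.unop m' : Γ(N, U.unop))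
          map_smul' := fun a m => by
            refine (congrArg _ (Scheme.Modules.Hom.app_smul φ (U := U.unop) a m)).trans ?_
            exact smul_comm (M := Γ(X, U.unop)) (N := Γ(X, U.unop))
              (restrictFunctions U.unop r) a (φ.app U.unop m : Γ(N, U.unop)) }
      naturality := fun {U W} i => by
        ext m
        have h1 : φ.app W.unop (M.presheaf.map i m) = N.presheaf.map i (φ.app U.unop m) :=
          congr($(φ.mapPresheaf.naturality i) m)
        have h2 := Scheme.Modules.map_smul N i.unop
          (restrictFunctions U.unop r) (φ.app U.unop m)
        have h3 : X.presheaf.map i (restrictFunctions U.unop r) =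
            restrictFunctions W.unop r := by
          change (X.presheaf.map _ ≫ X.presheaf.map i) r = _
          rw [← X.presheaf.map_comp]
          rfl
        refine Eq.trans ?_ h2.symm
        exact (congrArg (fun y : Γ(N, W.unop) => restrictFunctions W.unop r • y) h1).trans
          (congrArg (fun a : Γ(X, W.unop) =>
            a • (show Γ(N, W.unop) from N.presheaf.map i (φ.app U.unop m))) h3.symm) } :
    M.val ⟶ N.val)

lemma smulHom_app {M N : X.Modules} (r : Γ(X, ⊤)) (φ : M ⟶ N) (U : X.Opens) (m : Γ(M, U)) :
    (smulHom r φ).app U m = restrictFunctions U r • φ.app U m := rfl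

lemma hom_ext_apply {M N : X.Modules} {φ ψ : M ⟶ N}
    (h : ∀ (U : X.Opens) (m : Γ(M, U)), φ.app U m = ψ.app U m) : φ = ψ :=
  Scheme.Modules.hom_ext _ _ fun U => by ext m; exact h U m

/-- Morphisms of sheaves of modules form a module over the ring of global functions. -/
instance homModule (M N : X.Modules) : Module Γ(X, ⊤) (M ⟶ N) where
  smul := smulHom
  one_smul φ := hom_ext_apply fun U m =>
    (smulHom_app 1 φ U m).trans (by rw [map_one, one_smul])
  mul_smul a b φ := hom_ext_apply fun U m =>
    (smulHom_app (a * b) φ U m).trans (by rw [map_mul, mul_smul]; rfl)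
  smul_zero a := hom_ext_apply fun U m =>
    (smulHom_app a 0 U m).trans
      (show restrictFunctions U a • (0 : Γ(N, U)) = 0 by rw [smul_zero])
  smul_add a φ ψ := hom_ext_apply fun U m =>
    (smulHom_app a (φ + ψ) U m).trans (smul_add (restrictFunctions U a) (φ.app U m) (ψ.app U m))
  add_smul a b φ := hom_ext_apply fun U m =>
    (smulHom_app (a + b) φ U m).trans (by rw [map_add, add_smul]; rfl)
  zero_smul φ := hom_ext_apply fun U m =>
    (smulHom_app 0 φ U m).trans (by rw [map_zero, zero_smul]; rfl)

variable (k : Type u) [Field k]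

/-- The constants among the functions on an open set of a scheme over `k`. -/
def constants (X : Scheme.{u}) [X.Over (Spec (CommRingCat.of k))] (U : X.Opens) :
    k →+* Γ(X, U) :=
  (restrictFunctions U).comp ((Scheme.ΓSpecIso (CommRingCat.of k)).inv ≫
    (X ↘ Spec (CommRingCat.of k)).appTop).hom

/-- On a scheme over `k`, morphisms of sheaves of modules form a vector space over `k`. -/
instance homVectorSpace [X.Over (Spec (CommRingCat.of k))] (M N : X.Modules) :
    Module k (M ⟶ N) :=
  Module.compHom (M ⟶ N) (constants k X ⊤)

/-- A projective scheme over `k`: it admits a closed immersion over `k` into some projective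
space over `k`. -/
def IsProjective (X : Scheme.{u}) [X.Over (Spec (CommRingCat.of k))] : Prop :=
  ∃ (N : ℕ) (i : X ⟶ Proj (MvPolynomial.homogeneousSubmodule (Fin (N + 1)) k)),
    IsClosedImmersion i ∧
      i ≫ Proj.toSpecZero (MvPolynomial.homogeneousSubmodule (Fin (N + 1)) k) ≫
        Spec.map (CommRingCat.ofHom
          (algebraMap k (MvPolynomial.homogeneousSubmodule (Fin (N + 1)) k 0))) =
      X ↘ Spec (CommRingCat.of k)

/-- `Ext^m(M, N) = 0` in the category of sheaves of modules. -/
def ExtVanishes (M N : X.Modules) (m : ℕ) : Prop :=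
  haveI := HasExt.standard X.Modules
  Subsingleton (Abelian.Ext M N m)

/-- A coherent sheaf of modules (on a locally Noetherian scheme): locally a cokernel of a
morphism between free sheaves of finite rank. -/
def IsCoherent (M : X.Modules) : Prop :=
  SheafOfModules.IsFinitePresentation (R := X.ringCatSheaf) M

/-- The family `E` restricted to indices satisfying `S` spans the unbounded derived category of
complexes with coherent cohomology: an object `K` such that every morphism from an `E i` to a shift
of `K` vanishes is a zero object. -/
def SpansDerivedCategory (S : Set ℤ) (E : ℤ → X.Modules) : Prop :=
  letI := HasDerivedCategory.standard X.Modules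
  ∀ K : DerivedCategory X.Modules,
    (∀ m : ℤ, IsCoherent ((DerivedCategory.homologyFunctor X.Modules m).obj K)) →
    (∀ i ∈ S, ∀ (m : ℤ)
      (φ : (DerivedCategory.singleFunctor X.Modules 0).obj (E i) ⟶
        (CategoryTheory.shiftFunctor (DerivedCategory X.Modules) m).obj K), φ = 0) →
    Limits.IsZero K

/-- `E 1, …, E n` is a full, strong, exceptional collection on the scheme `X` over `k`. -/
structure IsFullStrongExceptional [X.Over (Spec (CommRingCat.of k))] (n : ℕ)
    (E : ℤ → X.Modules) : Prop where
  /-- The endomorphisms of each member are the scalars. -/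
  endomorphisms : ∀ i ∈ Set.Icc (1 : ℤ) n, Function.Bijective (fun c : k => c • 𝟙 (E i))
  /-- There are no morphisms and no extensions from a later member to an earlier one. -/
  exceptional : ∀ i ∈ Set.Icc (1 : ℤ) n, ∀ j ∈ Set.Icc (1 : ℤ) n, j < i →
    ∀ m : ℕ, ExtVanishes (E i) (E j) m
  /-- There are no higher extensions. -/
  strong : ∀ i ∈ Set.Icc (1 : ℤ) n, ∀ j ∈ Set.Icc (1 : ℤ) n,
    ∀ m : ℕ, m ≠ 0 → ExtVanishes (E i) (E j) m
  full : SpansDerivedCategory (Set.Icc (1 : ℤ) n) E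

/-- `E` is a simple spiral with respect to `L`, generated by the full, strong, exceptional
collection `E 1, …, E n`. -/
structure IsSimpleSpiral [X.Over (Spec (CommRingCat.of k))] (L : X.Modules) (n : ℕ)
    (E : ℤ → X.Modules) : Prop where
  collection : IsFullStrongExceptional k n E
  periodic : ∀ i : ℤ, Nonempty (E (i - n) ≅ tensor (E i) L)
  simple : ∀ i j : ℤ, i ≤ j → ∀ m : ℕ, m ≠ 0 → ExtVanishes (E i) (E j) m

end SchemeModules

section Quivers

open Quiver

variable (k : Type u) [Field k] (Q : Type) [Quiver.{u} Q]

/-- An admissible ideal of relations in the path algebra of the quiver `Q`: a two-sided ideal,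
homogeneous with respect to the end points of the paths, contained in the square of the ideal
spanned by the paths of positive length. -/
structure AdmissibleIdeal where
  /-- The relations among the paths from `a` to `b`. -/
  rel : ∀ a b : Q, Submodule k (Path a b →₀ k)
  comp_right : ∀ {a b c : Q} (p : Path b c), ∀ r ∈ rel a b,
    Finsupp.mapDomain (fun q : Path a b => q.comp p) r ∈ rel a c
  comp_left : ∀ {a b c : Q} (p : Path a b), ∀ r ∈ rel b c,
    Finsupp.mapDomain (fun q : Path b c => p.comp q) r ∈ rel a c
  two_le_length : ∀ {a b : Q}, ∀ r ∈ rel a b, ∀ p ∈ r.support, 2 ≤ p.length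

variable {k Q}

/-- An isomorphism of the path algebra `P(Q, I)` of a quiver with relations with
`End(⨁ E_a)ᵒᵖ`, taking the trivial path at `a` to the idempotent of `E_a`.
It consists of `k`-linear isomorphisms from the paths from `a` to `b` modulo relations
to `Hom(E_b, E_a)` which take concatenation of paths to (opposite) composition. -/
structure PathAlgebraIso (I : AdmissibleIdeal k Q) {V : Scheme.{u}}
    [V.Over (Spec (CommRingCat.of k))] (E : Q → V.Modules) where
  iso : ∀ a b : Q, ((Path a b →₀ k) ⧸ I.rel a b) ≃ₗ[k] (E b ⟶ E a)
  iso_nil : ∀ a : Q,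
    iso a a (Submodule.Quotient.mk (Finsupp.single Path.nil 1)) = 𝟙 (E a)
  iso_comp : ∀ {a b c : Q} (p : Path a b) (q : Path b c),
    iso a c (Submodule.Quotient.mk (Finsupp.single (p.comp q) 1)) =
      iso b c (Submodule.Quotient.mk (Finsupp.single q 1)) ≫
        iso a b (Submodule.Quotient.mk (Finsupp.single p 1))

/-- The morphism `E_b ⟶ E_a` that corresponds to an arrow from `a` to `b`. -/
def PathAlgebraIso.arrow {I : AdmissibleIdeal k Q} {V : Scheme.{u}}
    [V.Over (Spec (CommRingCat.of k))] {E : Q → V.Modules} (Φ : PathAlgebraIso I E)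
    {a b : Q} (e : a ⟶ b) : E b ⟶ E a :=
  Φ.iso a b (Submodule.Quotient.mk (Finsupp.single e.toPath 1))

variable (k Q) in
/-- The coordinate ring of the space of representations of the quiver `Q` (without relations) with
the space `k` at each node: one coordinate for each arrow. -/
abbrev ArrowPolynomial : Type u := MvPolynomial (Σ a b : Q, (a ⟶ b)) k

/-- The function that takes a representation to the value on a path. -/
def pathMonomial {a : Q} : ∀ {b : Q}, Path a b → ArrowPolynomial k Q
  | _, Path.nil => 1
  | _, Path.cons p e => pathMonomial p * MvPolynomial.X ⟨_, _, e⟩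

/-- The function that takes a representation to the value on a linear combination of paths. -/
def pathFunction {a b : Q} (r : Path a b →₀ k) : ArrowPolynomial k Q :=
  r.sum fun p c => MvPolynomial.C c * pathMonomial p

/-- The equations of the scheme of representations of `(Q, I)` with the space `k` at each node. -/
def representationIdeal (I : AdmissibleIdeal k Q) : Ideal (ArrowPolynomial k Q) :=
  Ideal.span {f | ∃ (a b : Q), ∃ r ∈ I.rel a b, f = pathFunction r}

/-- The affine coordinate ring `B` of the scheme of representations of `(Q, I)` with
dimension vector `(1, …, 1)`. -/
abbrev RepresentationRing (I : AdmissibleIdeal k Q) : Type u :=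
  ArrowPolynomial k Q ⧸ representationIdeal I

/-- The action of the torus `∏ₐ GL(1)` on the functions on the space of representations of `Q`:
the coordinate of an arrow from `a` to `b` is multiplied by `g_b * g_a⁻¹`. -/
def arrowAction (g : Q → kˣ) : ArrowPolynomial k Q →ₐ[k] ArrowPolynomial k Q :=
  MvPolynomial.aeval fun e =>
    MvPolynomial.C ((g e.2.1 * (g e.1)⁻¹ : kˣ) : k) * MvPolynomial.X e

lemma arrowAction_pathMonomial (g : Q → kˣ) {a b : Q} (p : Path a b) :
    arrowAction g (pathMonomial (k := k) p) =
      MvPolynomial.C ((g b * (g a)⁻¹ : kˣ) : k) * pathMonomial p := by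
  induction p with
  | nil => simp [pathMonomial]
  | @cons b c p e ih =>
    rw [pathMonomial, map_mul, ih, arrowAction, MvPolynomial.aeval_X]
    have h : g c * (g a)⁻¹ = (g b * (g a)⁻¹) * (g c * (g b)⁻¹) := by
      rw [mul_comm (g b), mul_mul_mul_comm, mul_comm (g a)⁻¹, mul_inv_cancel,
        mul_one]
    rw [h]
    generalize g b * (g a)⁻¹ = x
    generalize g c * (g b)⁻¹ = y
    rw [Units.val_mul, MvPolynomial.C_mul]
    ring

lemma arrowAction_pathFunction (g : Q → kˣ) {a b : Q} (r : Path a b →₀ k) :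
    arrowAction g (pathFunction r) =
      MvPolynomial.C ((g b * (g a)⁻¹ : kˣ) : k) * pathFunction r := by
  rw [pathFunction, Finsupp.sum, map_sum, Finset.mul_sum]
  refine Finset.sum_congr rfl fun p _ => ?_
  rw [map_mul, arrowAction_pathMonomial, ← MvPolynomial.algebraMap_eq, AlgHom.commutes]
  ring

lemma representationIdeal_le_comap (I : AdmissibleIdeal k Q) (g : Q → kˣ) :
    representationIdeal I ≤ (representationIdeal I).comap (arrowAction g) := by
  refine Ideal.span_le.2 ?_
  rintro _ ⟨a, b, r, hr, rfl⟩
  change arrowAction g _ ∈ representationIdeal I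
  rw [arrowAction_pathFunction]
  exact Ideal.mul_mem_left _ _ (Ideal.subset_span ⟨a, b, r, hr, rfl⟩)

/-- The action of the torus `∏ₐ GL(1)` on the ring `B`. The diagonal acts trivially, so that this
is an action of `G = ∏ₐ GL(1) / GL(1)`. -/
def torusAction (I : AdmissibleIdeal k Q) (g : Q → kˣ) :
    RepresentationRing I →ₐ[k] RepresentationRing I :=
  Ideal.quotientMapₐ _ (arrowAction g) (representationIdeal_le_comap I g)

/-- The ring of invariants `B^G`. (The field `k` being infinite, it is enough to
ask for invariance under the `k`-points of the torus.) -/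
def invariants (I : AdmissibleIdeal k Q) : Subalgebra k (RepresentationRing I) :=
  ⨅ g : Q → kˣ, AlgHom.equalizer (torusAction I g) (AlgHom.id k _)

/-- The affine quotient `M₀ = Spec B^G`. -/
def affineQuotient (I : AdmissibleIdeal k Q) : Scheme.{u} :=
  Spec (CommRingCat.of (invariants I))

/-- The function on the open set `U` by which a morphism `φ : M ⟶ N` is given in
trivializations of `M` and `N` over `U`. -/
def coordinate {V : Scheme.{u}} {M N : V.Modules} (U : V.Opens)
    (s : M.restrict U.ι ≅ structureSheaf U) (t : N.restrict U.ι ≅ structureSheaf U)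
    (φ : M ⟶ N) : Γ(V, U) :=
  U.topIso.hom ((s.inv ≫ (Scheme.Modules.restrictFunctor U.ι).map φ ≫ t.hom).app ⊤
    (1 : Γ(U, ⊤)))

/-- A ring homomorphism `τ : B^G → Γ(𝒪_V)` is the pullback of functions along the
tautological map `T`, which takes a point `p` to the representation on the fibres at `p` of the
duals of the line bundles `E_a`: over every open set `U`, and
for all trivializations of the `E_a` over `U` (that is, for every lift of `T` over `U` to a
morphism from `U` to the scheme of representations), the function `τ f` is
the value of the invariant `f` on the family of representations over `U`. -/
def IsTautologicalPullback {I : AdmissibleIdeal k Q} {V : Scheme.{u}}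
    [V.Over (Spec (CommRingCat.of k))] {E : Q → V.Modules} (Φ : PathAlgebraIso I E)
    (τ : invariants I →+* Γ(V, ⊤)) : Prop :=
  ∀ (U : V.Opens) (t : ∀ a : Q, (E a).restrict U.ι ≅ structureSheaf U)
    (f : ArrowPolynomial k Q) (hf : Ideal.Quotient.mk (representationIdeal I) f ∈ invariants I),
    restrictFunctions U (τ ⟨Ideal.Quotient.mk (representationIdeal I) f, hf⟩) =
      MvPolynomial.eval₂ (constants k V U)
        (fun e => coordinate U (t e.2.1) (t e.1) (Φ.arrow e.2.2)) f

end Quivers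

section Components

variable {M : Scheme.{u}} (Z : Set M)

/-- The canonical reduced closed subscheme on an irreducible component. -/
def reducedComponentIdeal (hZ : Z ∈ irreducibleComponents M) : M.IdealSheafData :=
  Scheme.IdealSheafData.vanishingIdeal
    ⟨Z, isClosed_of_mem_irreducibleComponents Z hZ⟩

/-- The points that do not lie in the closure of the union of the irreducible components
other than `Z`. -/
def componentOpen : M.Opens :=
  ⟨(closure (⋃₀ (irreducibleComponents M \ {Z})))ᶜ, isClosed_closure.isOpen_compl⟩

/-- The ideal sheaf of an irreducible component `Z` with its scheme structure: the functions
that vanish on the complement of the other irreducible components. -/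
def componentIdeal : M.IdealSheafData :=
  (componentOpen Z).ι.ker

end Components

end BondalSpiral

end

/-! A combination of closed paths at a node `a` acts on the line bundle `π^*E_a` as an endomorphism,
and an endomorphism of a line bundle is multiplication by a function. So functions on `V` correspond
to the invariants given by closed paths at one fixed node. The point is that these account for all
of `B^G` after one function is inverted.

Existence of `τ`: local frames of the `π^*E_a` evaluate polynomials in the arrows, relations go to
zero, and invariants have representatives made of balanced monomials (every node is as often a
source as a target), whose values do not depend on the frame (`exists_balanced`, `frameEvalQ_eq`).

Surjectivity of `τ`: multiplication by a global function `r` on `π^*E_a` comes from closed paths at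
`a`, and the resulting invariant pulls back to `r` (`tautologicalPullback_surjective`). Hence `φ₀`
is a closed immersion.

Kernel of `τ`: fix a node `a₀`. A section of a power of the ample bundle `L⁻¹` is a function on `V`,
homogeneous along the fibres, and for a suitable section its non-vanishing locus is affine
(`exists_isAffineOpen_basicOpen`). So local functions on `V` are quotients of global ones
(`hasGlobalFractions`), and clearing denominators gives non-zero `ν_a : E_{a₀} ⟶ E_a` and `μ_a : E_a
⟶ E_{a₀}`. Let `c` be the product of all `ν_a μ_a`. Multiplication by a power of `c` completes each
arrow of a balanced monomial to a closed walk through `a₀` (`exists_pow_mul_aeval_mem`), so `c ^ N *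
y` comes from a single endomorphism `ψ` of `E_{a₀}`. If `τ y = 0` then `ψ = 0`, hence `c ^ N * y =
0`; and `τ c ≠ 0` since `V` is integral.

Thus the closed irreducible image of `φ₀` contains the non-empty open set `c ≠ 0`, which makes it a
component; the reducedness of `Spec Γ(V, ⊤)` identifies the scheme structures. -/

noncomputable section

namespace BondalSpiral

/-! ### Sections of sheaves of modules, gluing, local bases. -/

section Sections

variable {X : Scheme.{u}}

/-- Restriction of functions. -/
def fres {U V : X.Opens} (h : V ≤ U) : Γ(X, U) →+* Γ(X, V) :=
  (X.presheaf.map (homOfLE h).op).hom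

/-- Restriction of sections of a sheaf of modules. -/
def mres (M : X.Modules) {U V : X.Opens} (h : V ≤ U) : Γ(M, U) →+ Γ(M, V) :=
  (M.presheaf.map (homOfLE h).op).hom

lemma fres_fres {U V W : X.Opens} (h : V ≤ U) (h' : W ≤ V) (a : Γ(X, U)) :
    fres h' (fres h a) = fres (h'.trans h) a := by
  change (X.presheaf.map _ ≫ X.presheaf.map _) a = _
  rw [← X.presheaf.map_comp]
  rfl

@[simp] lemma fres_self {U : X.Opens} (h : U ≤ U) (a : Γ(X, U)) : fres h a = a := by
  change X.presheaf.map (𝟙 _) a = _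
  rw [X.presheaf.map_id]
  rfl

variable {M N K : X.Modules}

lemma mres_mres {U V W : X.Opens} (h : V ≤ U) (h' : W ≤ V) (a : Γ(M, U)) :
    mres M h' (mres M h a) = mres M (h'.trans h) a := by
  change (M.presheaf.map _ ≫ M.presheaf.map _) a = _
  rw [← M.presheaf.map_comp]
  rfl

@[simp] lemma mres_self {U : X.Opens} (h : U ≤ U) (a : Γ(M, U)) : mres M h a = a := by
  change M.presheaf.map (𝟙 _) a = _
  rw [M.presheaf.map_id]
  rfl

lemma mres_smul {U V : X.Opens} (h : V ≤ U) (a : Γ(X, U)) (m : Γ(M, U)) :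
    mres M h (a • m) = fres h a • mres M h m :=
  Scheme.Modules.map_smul M (homOfLE h) a m

lemma app_mres (φ : M ⟶ N) {U V : X.Opens} (h : V ≤ U) (m : Γ(M, U)) :
    φ.app V (mres M h m) = mres N h (φ.app U m) :=
  congr($(φ.mapPresheaf.naturality (homOfLE h).op) m)

lemma app_smul (φ : M ⟶ N) {U : X.Opens} (a : Γ(X, U)) (m : Γ(M, U)) :
    φ.app U (a • m) = a • φ.app U m :=
  Scheme.Modules.Hom.app_smul φ a m

lemma restrictFunctions_eq (U : X.Opens) : restrictFunctions U = fres (le_top : U ≤ ⊤) := rfl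

lemma fres_restrictFunctions {U V : X.Opens} (h : V ≤ U) (a : Γ(X, ⊤)) :
    fres h (restrictFunctions U a) = restrictFunctions V a := by
  simp only [restrictFunctions_eq, fres_fres]

/-- Sections that agree locally are equal. -/
lemma section_ext {U : X.Opens} {m n : Γ(M, U)}
    (h : ∀ x ∈ U, ∃ (V : X.Opens) (hV : V ≤ U), x ∈ V ∧ mres M hV m = mres M hV n) : m = n := by
  choose V hV hx e using h
  refine TopCat.Sheaf.eq_of_locally_eq' (⟨M.presheaf, M.isSheaf⟩ : TopCat.Sheaf Ab X)
    (fun x : U => V x.1 x.2) U (fun x => homOfLE (hV x.1 x.2)) ?_ m n fun x => e x.1 x.2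
  intro x hxU
  exact Opens.mem_iSup.2 ⟨⟨x, hxU⟩, hx x hxU⟩

lemma function_ext {U : X.Opens} {m n : Γ(X, U)}
    (h : ∀ x ∈ U, ∃ (V : X.Opens) (hV : V ≤ U), x ∈ V ∧ fres hV m = fres hV n) : m = n := by
  choose V hV hx e using h
  refine TopCat.Sheaf.eq_of_locally_eq' X.sheaf
    (fun x : U => V x.1 x.2) U (fun x => homOfLE (hV x.1 x.2)) ?_ m n fun x => e x.1 x.2
  intro x hxU
  exact Opens.mem_iSup.2 ⟨⟨x, hxU⟩, hx x hxU⟩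

/-- Gluing of sections. -/
lemma section_glue {U : X.Opens} {ι : Type u} (V : ι → X.Opens) (hV : ∀ i, V i ≤ U)
    (hU : ∀ x ∈ U, ∃ i, x ∈ V i) (m : ∀ i, Γ(M, V i))
    (hm : ∀ i j, mres M (inf_le_left : V i ⊓ V j ≤ V i) (m i) =
      mres M (inf_le_right : V i ⊓ V j ≤ V j) (m j)) :
    ∃ n : Γ(M, U), ∀ i, mres M (hV i) n = m i := by
  obtain ⟨n, hn, -⟩ := TopCat.Sheaf.existsUnique_gluing'
    (⟨M.presheaf, M.isSheaf⟩ : TopCat.Sheaf Ab X) V U (fun i => homOfLE (hV i))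
    (fun x hx => Opens.mem_iSup.2 (hU x hx)) m hm
  exact ⟨n, hn⟩

lemma function_glue {U : X.Opens} {ι : Type u} (V : ι → X.Opens) (hV : ∀ i, V i ≤ U)
    (hU : ∀ x ∈ U, ∃ i, x ∈ V i) (m : ∀ i, Γ(X, V i))
    (hm : ∀ i j, fres (inf_le_left : V i ⊓ V j ≤ V i) (m i) =
      fres (inf_le_right : V i ⊓ V j ≤ V j) (m j)) :
    ∃ n : Γ(X, U), ∀ i, fres (hV i) n = m i := by
  obtain ⟨n, hn, -⟩ := TopCat.Sheaf.existsUnique_gluing'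
    X.sheaf V U (fun i => homOfLE (hV i))
    (fun x hx => Opens.mem_iSup.2 (hU x hx)) m hm
  exact ⟨n, hn⟩

/-- A section that freely generates `M` over `U`. -/
def IsBasis (M : X.Modules) {U : X.Opens} (e : Γ(M, U)) : Prop :=
  ∀ (V : X.Opens) (h : V ≤ U), Function.Bijective (fun a : Γ(X, V) => a • mres M h e)

namespace IsBasis

variable {U V : X.Opens} {e : Γ(M, U)}

lemma restrict (he : IsBasis M e) (h : V ≤ U) : IsBasis M (mres M h e) := fun W hW => by
  simpa only [mres_mres] using he W (hW.trans h)

lemma bijective (he : IsBasis M e) : Function.Bijective (fun a : Γ(X, U) => a • e) := by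
  simpa using he U le_rfl

/-- The coordinate of a section in a basis. -/
def coord (he : IsBasis M e) (m : Γ(M, U)) : Γ(X, U) := (he.bijective.2 m).choose

@[simp] lemma coord_smul (he : IsBasis M e) (m : Γ(M, U)) : he.coord m • e = m :=
  (he.bijective.2 m).choose_spec

lemma smul_injective (he : IsBasis M e) {a b : Γ(X, U)} (h : a • e = b • e) : a = b :=
  he.bijective.1 h

lemma coord_eq (he : IsBasis M e) {m : Γ(M, U)} {a : Γ(X, U)} (h : a • e = m) :
    he.coord m = a := he.smul_injective (by rw [coord_smul, h])

lemma fres_coord (he : IsBasis M e) (h : V ≤ U) (m : Γ(M, U)) :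
    fres h (he.coord m) = (he.restrict h).coord (mres M h m) :=
  ((he.restrict h).coord_eq (by rw [← mres_smul, coord_smul])).symm

lemma exists_unit (he : IsBasis M e) {e' : Γ(M, U)} (he' : IsBasis M e') :
    ∃ w : Γ(X, U)ˣ, e' = (w : Γ(X, U)) • e := by
  refine ⟨⟨he.coord e', he'.coord e, ?_, ?_⟩, (he.coord_smul e').symm⟩
  · apply he.smul_injective
    rw [mul_comm, mul_smul, coord_smul, coord_smul, one_smul]
  · apply he'.smul_injective
    rw [mul_comm, mul_smul, coord_smul, coord_smul, one_smul]

lemma unit_smul (he : IsBasis M e) (w : Γ(X, U)ˣ) : IsBasis M ((w : Γ(X, U)) • e) := by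
  intro W hW
  rw [mres_smul]
  have : (fun a : Γ(X, W) => a • fres hW (w : Γ(X, U)) • mres M hW e) =
      (fun a : Γ(X, W) => a • mres M hW e) ∘
        (Units.mulRight (Units.map (fres hW : Γ(X, U) →* Γ(X, W)) w)) := by
    funext a
    simp [mul_smul]
  rw [this]
  exact (he W hW).comp (Equiv.bijective _)

end IsBasis

/-- Morphisms out of a module with local bases are determined by the images of the bases. -/
lemma hom_ext_of_basis {φ ψ : M ⟶ N}
    (h : ∀ x : X, ∃ (U : X.Opens) (e : Γ(M, U)), x ∈ U ∧ IsBasis M e ∧ φ.app U e = ψ.app U e) :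
    φ = ψ := by
  refine hom_ext_apply fun W m => section_ext fun x hx => ?_
  obtain ⟨U, e, hxU, he, hφ⟩ := h x
  refine ⟨W ⊓ U, inf_le_left, ⟨hx, hxU⟩, ?_⟩
  rw [← app_mres, ← app_mres, ← (he.restrict (inf_le_right : W ⊓ U ≤ U)).coord_smul (mres M _ m),
    app_smul, app_smul, app_mres, app_mres, hφ]

end Sections

/-! ### Pullback of sections; local bases pull back to local bases. -/

section Pullback

variable {X Y T : Scheme.{u}} {M N : X.Modules}

lemma IsBasis.map_iso (φ : M ≅ N) {U : X.Opens} {e : Γ(M, U)} (he : IsBasis M e) :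
    IsBasis N (φ.hom.app U e) := by
  intro W hW
  rw [← app_mres]
  have : (fun a : Γ(X, W) => a • φ.hom.app W (mres M hW e)) =
      φ.hom.app W ∘ (fun a : Γ(X, W) => a • mres M hW e) := by
    funext a
    exact (app_smul φ.hom a _).symm
  rw [this]
  exact (ConcreteCategory.bijective_of_isIso (φ.hom.app W)).comp (he W hW)

lemma IsBasis.of_map_iso (φ : M ≅ N) {U : X.Opens} {e : Γ(M, U)}
    (he : IsBasis N (φ.hom.app U e)) : IsBasis M e := by
  have h : φ.inv.app U (φ.hom.app U e) = e := congr($(φ.hom_inv_id).app U e)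
  exact h ▸ he.map_iso φ.symm

lemma isBasis_one : IsBasis (structureSheaf X) (U := ⊤) (1 : Γ(X, ⊤)) := by
  intro W hW
  have : mres (structureSheaf X) hW (1 : Γ(X, ⊤)) = (1 : Γ(X, W)) := map_one (fres hW)
  rw [this]
  have h2 : (fun a : Γ(X, W) => (a • (1 : Γ(X, W)) : Γ(structureSheaf X, W))) = id := by
    funext a
    exact mul_one a
  exact h2 ▸ Function.bijective_id

/-- The morphism from the structure sheaf given by a global section. -/
def homOfSection (e : Γ(M, ⊤)) : structureSheaf X ⟶ M :=
  (SheafOfModules.unitHomEquiv M).symm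
    { val := fun U => mres M (le_top : U.unop ≤ ⊤) e
      property := fun {U _} i => mres_mres (le_top : U.unop ≤ ⊤) i.unop.le e }

lemma homOfSection_app_one (e : Γ(M, ⊤)) (U : X.Opens) :
    (homOfSection e).app U (1 : Γ(X, U)) = mres M le_top e :=
  congrArg (fun t : SheafOfModules.sections M => t.val (Opposite.op U))
    ((SheafOfModules.unitHomEquiv M).apply_symm_apply _)

lemma homOfSection_app (e : Γ(M, ⊤)) {U : X.Opens} (a : Γ(X, U)) :
    (homOfSection e).app U a = a • mres M le_top e := by
  have h1 := homOfSection_app_one e U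
  have h2 := app_smul (homOfSection e) a (show Γ(structureSheaf X, U) from (1 : Γ(X, U)))
  rw [show (homOfSection e).app U (show Γ(structureSheaf X, U) from (1 : Γ(X, U))) =
    mres M le_top e from h1] at h2
  rw [← h2]
  congr 1
  exact (mul_one a).symm

lemma IsBasis.isIso_homOfSection {e : Γ(M, ⊤)} (he : IsBasis M e) : IsIso (homOfSection e) := by
  rw [Scheme.Modules.Hom.isIso_iff_isIso_app]
  intro U
  rw [ConcreteCategory.isIso_iff_bijective]
  have : ⇑((homOfSection e).app U) = (fun a : Γ(X, U) => a • mres M le_top e) :=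
    funext fun a => homOfSection_app e a
  rw [this]
  exact he U le_top

/-- The structure sheaf is isomorphic to a module with a global basis. -/
def IsBasis.iso {e : Γ(M, ⊤)} (he : IsBasis M e) : structureSheaf X ≅ M :=
  haveI := he.isIso_homOfSection
  asIso (homOfSection e)

lemma IsBasis.iso_hom_app {e : Γ(M, ⊤)} (he : IsBasis M e) {U : X.Opens} (a : Γ(X, U)) :
    he.iso.hom.app U a = a • mres M le_top e := homOfSection_app e a

/-- The pullback of sections over open sets. -/
def pb (f : T ⟶ X) {U : X.Opens} (m : Γ(M, U)) :
    Γ((Scheme.Modules.pullback f).obj M, f ⁻¹ᵁ U) :=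
  ((Scheme.Modules.pullbackPushforwardAdjunction f).unit.app M).app U m

lemma pullbackSection_eq_pb (f : T ⟶ X) (m : Γ(M, ⊤)) : pullbackSection f m = pb f m := rfl

lemma pb_mres (f : T ⟶ X) {U V : X.Opens} (h : V ≤ U) (m : Γ(M, U)) :
    pb f (mres M h m) = mres _ (f.preimage_mono h) (pb f m) :=
  app_mres ((Scheme.Modules.pullbackPushforwardAdjunction f).unit.app M) h m

lemma pb_smul (f : T ⟶ X) {U : X.Opens} (a : Γ(X, U)) (m : Γ(M, U)) :
    pb f (a • m) = f.app U a • pb f m :=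
  app_smul ((Scheme.Modules.pullbackPushforwardAdjunction f).unit.app M) a m

lemma pb_map (f : T ⟶ X) (φ : M ⟶ N) {U : X.Opens} (m : Γ(M, U)) :
    ((Scheme.Modules.pullback f).map φ).app _ (pb f m) = pb f (φ.app U m) := by
  have := (Scheme.Modules.pullbackPushforwardAdjunction f).unit.naturality φ
  exact congr($(this).app U m).symm

/-- `pullbackComp` is the mate of the identification of the pushforwards, so it is compatible with
the units of the adjunctions, which are what `pb` is made of. -/
lemma pb_comp (g : Y ⟶ T) (f : T ⟶ X) {U : X.Opens} (m : Γ(M, U)) :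
    ((Scheme.Modules.pullbackComp g f).hom.app M).app _ (pb g (pb f m)) = pb (g ≫ f) m := by
  have h := unit_conjugateEquiv
    ((Scheme.Modules.pullbackPushforwardAdjunction f).comp
      (Scheme.Modules.pullbackPushforwardAdjunction g))
    (Scheme.Modules.pullbackPushforwardAdjunction (g ≫ f))
    (Scheme.Modules.pullbackComp g f).inv M
  rw [Scheme.Modules.conjugateEquiv_pullbackComp_inv] at h
  have h2 : pb g (pb f m) = ((Scheme.Modules.pullbackComp g f).inv.app M).app _ (pb (g ≫ f) m) :=
    congr($(h).app U m)
  rw [h2]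
  exact congr($((Scheme.Modules.pullbackComp g f).inv_hom_id_app M).app _ _)

lemma pb_restrict (f : T ⟶ X) [IsOpenImmersion f] {U : X.Opens} (m : Γ(M, U)) :
    ((Scheme.Modules.restrictFunctorIsoPullback f).hom.app M).app _
      (show Γ(M.restrict f, f ⁻¹ᵁ U) from mres M (f.image_preimage_le U) m) = pb f m := by
  have := Adjunction.unit_leftAdjointUniq_hom_app (Scheme.Modules.restrictAdjunction f)
    (Scheme.Modules.pullbackPushforwardAdjunction f) M
  exact congr($(this).app U m)

lemma isIso_pullbackObjUnitToUnit {C D : Type*} [Category* C] [Category* D]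
    {J : GrothendieckTopology C} {K : GrothendieckTopology D} {F : C ⥤ D}
    {S : Sheaf J RingCat.{u}} {R : Sheaf K RingCat.{u}} [Functor.IsContinuous F J K]
    (φ : S ⟶ (F.sheafPushforwardContinuous RingCat.{u} J K).obj R)
    (hR : (SheafOfModules.pushforward.{u} φ).IsRightAdjoint) (hF : F.Final) :
    IsIso (SheafOfModules.pullbackObjUnitToUnit φ) := inferInstance

/-- Among the opens whose preimage contains `W` there is a largest one, the whole space, so the
comma category is connected. Finality makes the pullback of the unit module the unit module. -/
lemma final_opens_map (f : T ⟶ X) : (Opens.map f.base).Final where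
  out W := by
    have hT : Limits.IsTerminal
        (StructuredArrow.mk (S := W) (T := Opens.map f.base) (Y := ⊤) (homOfLE le_top)) :=
      Limits.IsTerminal.ofUniqueHom
        (fun A => StructuredArrow.homMk (homOfLE le_top) (Subsingleton.elim _ _))
        (fun A m => StructuredArrow.hom_ext _ _ (Subsingleton.elim _ _))
    have := hT.hasTerminal
    exact isConnected_of_hasTerminal _

/-- The adjoint `G` of `𝒪_X ⟶ f_* 𝒪_T` is an isomorphism, and it takes the pulled back `1` to `1`.
-/
lemma isBasis_pb_one (f : T ⟶ X) :
    IsBasis _ (pb f (M := structureSheaf X) (U := ⊤) (1 : Γ(X, ⊤))) := by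
  let F : structureSheaf X ⟶ (Scheme.Modules.pushforward f).obj (structureSheaf T) :=
    SheafOfModules.unitToPushforwardObjUnit f.toRingCatSheafHom
  let G : (Scheme.Modules.pullback f).obj (structureSheaf X) ⟶ structureSheaf T :=
    ((Scheme.Modules.pullbackPushforwardAdjunction f).homEquiv _ _).symm F
  have hR : (SheafOfModules.pushforward.{u} f.toRingCatSheafHom).IsRightAdjoint :=
    (Scheme.Modules.pullbackPushforwardAdjunction f).isRightAdjoint
  have hG : IsIso G :=
    isIso_pullbackObjUnitToUnit f.toRingCatSheafHom hR (final_opens_map f)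
  have h1 : (Scheme.Modules.pullbackPushforwardAdjunction f).unit.app _ ≫
      (Scheme.Modules.pushforward f).map G = F := by
    exact ((Scheme.Modules.pullbackPushforwardAdjunction f).homEquiv_unit
      (structureSheaf X) (structureSheaf T) G).symm.trans (Equiv.apply_symm_apply _ _)
  have h2 : G.app ⊤ (pb f (M := structureSheaf X) (U := ⊤) (1 : Γ(X, ⊤))) = (1 : Γ(T, ⊤)) :=
    (congr($(h1).app ⊤ (1 : Γ(X, ⊤)))).trans (map_one (f.app ⊤).hom)
  have h3 := isBasis_one.map_iso (asIso G).symm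
  have h4 : (asIso G).symm.hom.app ⊤ (1 : Γ(T, ⊤)) =
      pb f (M := structureSheaf X) (U := ⊤) (1 : Γ(X, ⊤)) := by
    rw [← h2]
    exact congr($((asIso G).hom_inv_id).app ⊤ _)
  exact h4 ▸ h3

lemma IsBasis.pb_of_eq_top (f : T ⟶ X) {U : X.Opens} (hU : U = ⊤) {e : Γ(M, U)}
    (he : IsBasis M e) : IsBasis _ (pb f e) := by
  subst hU
  have h1 := (isBasis_pb_one f).map_iso ((Scheme.Modules.pullback f).mapIso he.iso)
  have h2 := pb_map f he.iso.hom (U := ⊤) (1 : Γ(X, ⊤))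
  rw [he.iso_hom_app, mres_self, one_smul] at h2
  exact h2 ▸ h1

/-- Opens below `U` correspond to opens below its image, and the two scalar actions differ by the
isomorphism `f.appIso`. -/
lemma isBasis_restrict_iff (f : T ⟶ X) [IsOpenImmersion f] {U : T.Opens} (e : Γ(M, f ''ᵁ U)) :
    IsBasis (M.restrict f) (U := U) e ↔ IsBasis M e := by
  have key (W : T.Opens) (hW : W ≤ U) :
      Function.Bijective (fun a : Γ(T, W) => a • mres (M.restrict f) hW e) ↔
      Function.Bijective (fun a : Γ(X, f ''ᵁ W) => a • mres M (f.image_mono hW) e) := by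
    have : (fun a : Γ(T, W) => a • mres (M.restrict f) hW e) =
      (fun a : Γ(X, f ''ᵁ W) => a • mres M (f.image_mono hW) e) ∘ (f.appIso W).inv := rfl
    rw [this]
    exact Function.Bijective.of_comp_iff _ (ConcreteCategory.bijective_of_isIso (f.appIso W).inv)
  constructor
  · intro h W hW
    obtain ⟨W', rfl⟩ : ∃ W', f ''ᵁ W' = W :=
      ⟨f ⁻¹ᵁ W, (f.image_preimage_eq_opensRange_inf W).trans
        (inf_eq_right.2 (hW.trans (f.image_le_opensRange U)))⟩
    have hW' : W' ≤ U := by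
      have := f.preimage_mono hW
      rwa [f.preimage_image_eq, f.preimage_image_eq] at this
    exact (key W' hW').1 (h W' hW')
  · intro h W hW
    exact (key W hW).2 (h _ (f.image_mono hW))

lemma IsBasis.pb_of_isOpenImmersion (f : T ⟶ X) [IsOpenImmersion f] {U : X.Opens} {e : Γ(M, U)}
    (he : IsBasis M e) : IsBasis _ (pb f e) := by
  rw [← pb_restrict]
  refine IsBasis.map_iso ((Scheme.Modules.restrictFunctorIsoPullback f).app M) ?_
  exact (isBasis_restrict_iff f _).2 (he.restrict _)

lemma isBasis_of_pb (f : T ⟶ X) [IsOpenImmersion f] {U : X.Opens} {e : Γ(M, U)}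
    (he : IsBasis _ (pb f e)) : IsBasis M (mres M (f.image_preimage_le U) e) := by
  rw [← pb_restrict] at he
  exact (isBasis_restrict_iff f _).1
    (IsBasis.of_map_iso ((Scheme.Modules.restrictFunctorIsoPullback f).app M) he)

lemma isBasis_pb_comp_iff (g : Y ⟶ T) (f : T ⟶ X) {U : X.Opens} (e : Γ(M, U)) :
    IsBasis _ (pb g (pb f e)) ↔ IsBasis _ (pb (g ≫ f) e) := by
  constructor
  · intro h
    rw [← pb_comp]
    exact IsBasis.map_iso ((Scheme.Modules.pullbackComp g f).app M) h
  · intro h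
    rw [← pb_comp] at h
    exact IsBasis.of_map_iso ((Scheme.Modules.pullbackComp g f).app M) h

/-- The pullback of a local basis is a local basis. -/
lemma IsBasis.pb (f : T ⟶ X) {U : X.Opens} {e : Γ(M, U)} (he : IsBasis M e) :
    IsBasis _ (pb f e) := by
  -- On the scheme `U` the basis is global, where the pullback of the unit module applies. The
  -- square formed by `f ∣_ U` and the two inclusions carries the result to `f`.
  have h1 : IsBasis _ (BondalSpiral.pb (f ∣_ U) (BondalSpiral.pb U.ι e)) :=
    (he.pb_of_isOpenImmersion U.ι).pb_of_eq_top (f ∣_ U) (by simp)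
  rw [isBasis_pb_comp_iff] at h1
  have h2 : ∀ {g h : (f ⁻¹ᵁ U).toScheme ⟶ X}, g = h → IsBasis _ (BondalSpiral.pb g e) →
      IsBasis _ (BondalSpiral.pb h e) := by
    rintro g _ rfl h
    exact h
  have h3 := h2 (morphismRestrict_ι f U) h1
  rw [← isBasis_pb_comp_iff] at h3
  have h4 := isBasis_of_pb (f ⁻¹ᵁ U).ι h3
  have h5 : f ⁻¹ᵁ U ≤ (f ⁻¹ᵁ U).ι ''ᵁ ((f ⁻¹ᵁ U).ι ⁻¹ᵁ (f ⁻¹ᵁ U)) := by simp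
  simpa only [mres_mres, mres_self] using h4.restrict h5

end Pullback

/-! ### Trivializations as local bases. -/

section Trivializations

variable {X : Scheme.{u}} {M N : X.Modules}

/-- The basis of `M` over `U` that corresponds to a trivialization. -/
def trivBasis {U : X.Opens} (s : M.restrict U.ι ≅ structureSheaf U) : Γ(M, U) :=
  mres M U.ι_image_top.ge (s.inv.app ⊤ (1 : Γ(U, ⊤)) : Γ(M, U.ι ''ᵁ ⊤))

lemma isBasis_trivBasis {U : X.Opens} (s : M.restrict U.ι ≅ structureSheaf U) :
    IsBasis M (trivBasis s) :=
  ((isBasis_restrict_iff U.ι _).1 (isBasis_one.map_iso s.symm)).restrict _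

/-- Links the `coordinate` of the definition of the tautological pullback to coordinates in local
bases, in which all later computations take place. -/
lemma coordinate_smul {U : X.Opens} (s : M.restrict U.ι ≅ structureSheaf U)
    (t : N.restrict U.ι ≅ structureSheaf U) (φ : M ⟶ N) :
    coordinate U s t φ • trivBasis t = φ.app U (trivBasis s) := by
  let x : Γ(U, ⊤) := (s.inv ≫ (Scheme.Modules.restrictFunctor U.ι).map φ ≫ t.hom).app ⊤
    (1 : Γ(U, ⊤))
  let y : Γ(N, U.ι ''ᵁ ⊤) := φ.app (U.ι ''ᵁ ⊤) (s.inv.app ⊤ (1 : Γ(U, ⊤)))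
  have hx : t.inv.app ⊤ x = y := congr($(t.hom_inv_id).app ⊤ y)
  have h1 : t.inv.app ⊤ x = x • (show Γ(N.restrict U.ι, ⊤) from t.inv.app ⊤ (1 : Γ(U, ⊤))) := by
    have := app_smul t.inv x (show Γ(structureSheaf U, ⊤) from (1 : Γ(U, ⊤)))
    refine Eq.trans ?_ this
    congr 1
    exact (mul_one x).symm
  let z : Γ(N, U.ι ''ᵁ ⊤) := t.inv.app ⊤ (1 : Γ(U, ⊤))
  have h2 : (U.ι.appIso ⊤).inv x • z = y := h1.symm.trans hx
  have h3 := congrArg (mres N U.ι_image_top.ge) h2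
  rw [mres_smul] at h3
  refine Eq.trans ?_ (h3.trans (app_mres φ _ _).symm)
  congr 1
  change U.topIso.hom x = fres _ ((U.ι.appIso ⊤).inv x)
  simp [Scheme.Opens.topIso, fres]
  rfl

/-- The trivialization that corresponds to a basis. -/
def IsBasis.triv {U : X.Opens} {e : Γ(M, U)} (he : IsBasis M e) :
    M.restrict U.ι ≅ structureSheaf U :=
  ((isBasis_restrict_iff U.ι (U := ⊤) _).2 (he.restrict U.ι_image_top.le)).iso.symm

lemma IsLineBundle.exists_isBasis (hM : IsLineBundle M) (x : X) :
    ∃ (U : X.Opens) (e : Γ(M, U)), x ∈ U ∧ IsBasis M e := by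
  obtain ⟨U, hx, ⟨s⟩⟩ := hM x
  exact ⟨U, trivBasis s, hx, isBasis_trivBasis s⟩

end Trivializations

/-! ### The total space is locally an affine line. -/

section TotalSpace

variable {X V T : Scheme.{u}} {π : V ⟶ X} {L : X.Modules}
  {s : Γ((Scheme.Modules.pullback π).obj L, ⊤)}

lemma app_fres (f : T ⟶ X) {U W : X.Opens} (h : W ≤ U) (a : Γ(X, U)) :
    f.app W (fres h a) = fres (f.preimage_mono h) (f.app U a) :=
  congr($(f.naturality (homOfLE h).op) a)

/-- The type of the section depends on the morphism. The coordinate `a` lives on `T`, independently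
of the morphism, so pairs can be compared through it. -/
lemma sigma_section_ext {U : X.Opens} {e : Γ(L, U)} {f₁ f₂ : T ⟶ X} (hf : f₁ = f₂)
    (hU : f₁ ⁻¹ᵁ U = ⊤) {x₁ : Γ((Scheme.Modules.pullback f₁).obj L, ⊤)}
    {x₂ : Γ((Scheme.Modules.pullback f₂).obj L, ⊤)} (a : Γ(T, ⊤))
    (h₁ : mres _ (le_top : f₁ ⁻¹ᵁ U ≤ ⊤) x₁ = fres (le_top : f₁ ⁻¹ᵁ U ≤ ⊤) a • pb f₁ e)
    (h₂ : mres _ (le_top : f₂ ⁻¹ᵁ U ≤ ⊤) x₂ = fres (le_top : f₂ ⁻¹ᵁ U ≤ ⊤) a • pb f₂ e) :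
    (⟨f₁, x₁⟩ : Σ f : T ⟶ X, Γ((Scheme.Modules.pullback f).obj L, ⊤)) = ⟨f₂, x₂⟩ := by
  subst hf
  congr 1
  exact section_ext fun x _ => ⟨f₁ ⁻¹ᵁ U, le_top, hU ▸ trivial, h₁.trans h₂.symm⟩

/-- The coordinate function of the total space in a local basis of the line bundle. -/
lemma mres_pullback_section {U : X.Opens} {e : Γ(L, U)} {t : Γ(V, π ⁻¹ᵁ U)}
    (ht : mres _ le_top s = t • pb π e) (g : T ⟶ V) (b : Γ(T, (g ≫ π) ⁻¹ᵁ U))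
    (hb : g.app (π ⁻¹ᵁ U) t = b) :
    mres _ (le_top : (g ≫ π) ⁻¹ᵁ U ≤ ⊤)
      (((Scheme.Modules.pullbackComp g π).hom.app L).app ⊤ (pullbackSection g s)) =
      b • pb (g ≫ π) e := by
  subst hb
  rw [← app_mres, pullbackSection_eq_pb]
  have h := pb_mres g (le_top : π ⁻¹ᵁ U ≤ ⊤) s
  rw [ht, pb_smul] at h
  have h2 := congrArg (((Scheme.Modules.pullbackComp g π).hom.app L).app (g ⁻¹ᵁ π ⁻¹ᵁ U)) h
  rw [app_smul, pb_comp] at h2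
  exact h2.symm

namespace IsTotalSpace

variable (hV : IsTotalSpace π L s)
include hV

/-- The universal property for the pair `(f, a • f^* e)`: over `U`, a point of `V` is a point of `X`
together with a value of the fibre coordinate `t`. -/
lemma exists_lift {U : X.Opens} {e : Γ(L, U)} (he : IsBasis L e) {t : Γ(V, π ⁻¹ᵁ U)}
    (ht : mres _ le_top s = t • pb π e) (f : T ⟶ X) (hU : f ⁻¹ᵁ U = ⊤) (a : Γ(T, ⊤)) :
    ∃ g : T ⟶ V, g ≫ π = f ∧ g.app (π ⁻¹ᵁ U) t = fres le_top a := by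
  obtain ⟨g, hg⟩ := (hV T).2 ⟨f, mres _ hU.ge (fres (le_top : f ⁻¹ᵁ U ≤ ⊤) a • pb f e)⟩
  have hg1 : g ≫ π = f := congrArg Sigma.fst hg
  subst hg1
  refine ⟨g, rfl, ?_⟩
  have hg2 := eq_of_heq (Sigma.ext_iff.1 hg).2
  apply (he.pb (g ≫ π)).smul_injective
  have h3 := mres_pullback_section ht g _ rfl
  dsimp only at hg2
  rw [hg2, mres_mres, mres_self] at h3
  exact h3.symm

lemma hom_ext {U : X.Opens} {e : Γ(L, U)} {t : Γ(V, π ⁻¹ᵁ U)}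
    (ht : mres _ le_top s = t • pb π e) {g₁ g₂ : T ⟶ V} (h : g₁ ≫ π = g₂ ≫ π)
    (hU : (g₁ ≫ π) ⁻¹ᵁ U = ⊤) (a : Γ(T, ⊤)) (h₁ : g₁.app (π ⁻¹ᵁ U) t = fres le_top a)
    (h₂ : g₂.app (π ⁻¹ᵁ U) t = fres le_top a) : g₁ = g₂ := by
  apply (hV T).1
  refine sigma_section_ext (e := e) h hU a ?_ ?_
  · exact mres_pullback_section ht g₁ _ h₁
  · exact mres_pullback_section ht g₂ _ h₂

/-- The section `U ⟶ V` given by `e` itself pulls `t` back to `1`. -/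
lemma ne_zero {U : X.Opens} {e : Γ(L, U)} (he : IsBasis L e) {t : Γ(V, π ⁻¹ᵁ U)}
    (ht : mres _ le_top s = t • pb π e) (hU : (U : Set X).Nonempty) : t ≠ 0 := by
  rintro rfl
  obtain ⟨x, hx⟩ := hU
  obtain ⟨g, h, hg⟩ := hV.exists_lift he ht U.ι (by simp) 1
  rw [map_zero, map_one] at hg
  have hg' : (g ≫ π) ⁻¹ᵁ U = ⊤ := by simp [h]
  have : Nonempty (g ⁻¹ᵁ π ⁻¹ᵁ U : U.toScheme.Opens) := ⟨⟨⟨x, hx⟩, hg'.ge trivial⟩⟩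
  have := Scheme.component_nontrivial U.toScheme (g ⁻¹ᵁ π ⁻¹ᵁ U)
  exact zero_ne_one hg

lemma preimage_nonempty {U : X.Opens} {e : Γ(L, U)} (he : IsBasis L e) {t : Γ(V, π ⁻¹ᵁ U)}
    (ht : mres _ le_top s = t • pb π e) (hU : (U : Set X).Nonempty) :
    (π ⁻¹ᵁ U : Set V).Nonempty := by
  obtain ⟨x, hx⟩ := hU
  obtain ⟨g, hg, -⟩ := hV.exists_lift he ht U.ι (by simp) 1
  refine ⟨g ⟨x, hx⟩, ?_⟩
  change (g ≫ π) ⟨x, hx⟩ ∈ U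
  rw [hg]
  exact hx

/-- Over an open set where the line bundle is trivial the total space is an affine line. -/
lemma exists_isIso {U : X.Opens} {e : Γ(L, U)} (he : IsBasis L e) {t : Γ(V, π ⁻¹ᵁ U)}
    (ht : mres _ le_top s = t • pb π e) :
    ∃ h : (π ⁻¹ᵁ U).toScheme ⟶ 𝔸(PUnit.{u + 1}; U.toScheme), IsIso h ∧
      h ≫ (𝔸(PUnit.{u + 1}; U.toScheme) ↘ U.toScheme) = π ∣_ U := by
  let W := π ⁻¹ᵁ U
  have hW : W.ι ⁻¹ᵁ W = ⊤ := by simp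
  let t' : Γ(W, ⊤) := fres hW.ge (W.ι.app W t)
  have ht' : W.ι.app W t = fres le_top t' := by
    simp only [t', fres_fres, fres_self]
  let p := 𝔸(PUnit.{u + 1}; U.toScheme) ↘ U.toScheme
  let h : W.toScheme ⟶ 𝔸(PUnit.{u + 1}; U.toScheme) :=
    AffineSpace.homOfVector (π ∣_ U) fun _ => t'
  have hp : h ≫ p = π ∣_ U := AffineSpace.homOfVector_over _ _
  -- The inverse of `h`: the point of `V` with values in the affine line whose fibre coordinate is
  -- the coordinate of that line. It lands over `U`, hence factors through `W`.
  obtain ⟨g, hg, hgt⟩ := hV.exists_lift he ht (p ≫ U.ι) (by simp)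
    (AffineSpace.coord U.toScheme PUnit.unit)
  have hgr : Set.range g ⊆ Set.range W.ι := by
    rintro _ ⟨x, rfl⟩
    rw [Scheme.Opens.range_ι]
    change (g ≫ π) x ∈ U
    rw [hg]
    exact (p x).2
  obtain ⟨g', rfl⟩ : ∃ g', g' ≫ W.ι = g := ⟨_, IsOpenImmersion.lift_fac W.ι g hgr⟩
  have hgW : g' ≫ π ∣_ U = p := by
    rw [← cancel_mono U.ι, Category.assoc, morphismRestrict_ι, ← Category.assoc, hg]
  refine ⟨h, ⟨g', ?_, ?_⟩, hp⟩
  · rw [← cancel_mono W.ι, Category.assoc, Category.id_comp]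
    refine hV.hom_ext ht ?_ ?_ t' ?_ ht'
    · rw [Category.assoc, hg, ← Category.assoc, hp, morphismRestrict_ι]
    · rw [Category.assoc, hg, ← Category.assoc, hp, morphismRestrict_ι]
      exact hW
    · have h1 : h.app _ ((g' ≫ W.ι).app (π ⁻¹ᵁ U) t) = h.app _ _ := congrArg _ hgt
      rw [app_fres] at h1
      have h2 : h.app ⊤ (AffineSpace.coord U.toScheme PUnit.unit) = t' :=
        AffineSpace.homOfVector_appTop_coord (π ∣_ U) (fun _ => t') PUnit.unit
      exact h1.trans (congrArg _ h2)
  · apply AffineSpace.hom_ext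
    · change (g' ≫ h) ≫ p = 𝟙 _ ≫ p
      rw [Category.assoc, hp, hgW, Category.id_comp]
    · rintro ⟨⟩
      have h2 : h.app ⊤ (AffineSpace.coord U.toScheme PUnit.unit) = t' :=
        AffineSpace.homOfVector_appTop_coord (π ∣_ U) (fun _ => t') PUnit.unit
      change g'.app ⊤ (h.app ⊤ (AffineSpace.coord U.toScheme PUnit.unit)) = _
      rw [h2]
      have h3 : g'.app _ (W.ι.app W t) = fres le_top (AffineSpace.coord U.toScheme PUnit.unit) :=
        hgt
      have h4 := app_fres g' hW.ge (W.ι.app W t)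
      rw [h3, fres_fres] at h4
      exact h4.trans (fres_self le_rfl _)

end IsTotalSpace

end TotalSpace

/-! ### Integral schemes: covers and restriction of functions. -/

section IntegralSchemes

variable {X : Scheme.{u}}

/-- A scheme covered by integral open subschemes, any two of which meet, is integral. -/
lemma isIntegral_of_cover [Nonempty X] {ι : Type*} (W : ι → X.Opens) (hW : ∀ x, ∃ i, x ∈ W i)
    (hint : ∀ i, IsIntegral (W i).toScheme)
    (hne : ∀ i j, ((W i ⊓ W j : X.Opens) : Set X).Nonempty) : IsIntegral X := by
  have hred : IsReduced X := by
    refine ⟨fun U => ⟨fun a ha => function_ext fun x hxU => ?_⟩⟩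
    obtain ⟨i, hi⟩ := hW x
    let O : X.Opens := (W i).ι ''ᵁ ((W i).ι ⁻¹ᵁ U)
    have hO : O ≤ U := (W i).ι.image_preimage_le U
    refine ⟨O, hO, ?_, ?_⟩
    · exact ⟨⟨x, hi⟩, hxU, rfl⟩
    · have h1 : _root_.IsReduced Γ(X, O) :=
        inferInstanceAs (_root_.IsReduced Γ((W i).toScheme, (W i).ι ⁻¹ᵁ U))
      rw [map_zero]
      exact (ha.map (fres hO)).eq_zero
  have hirr (i) : IsIrreducible (W i : Set X) := by
    have := hint i
    have h := (IrreducibleSpace.isIrreducible_univ (W i).toScheme).image (W i).ι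
      (W i).ι.continuous.continuousOn
    rwa [Set.image_univ, Scheme.Opens.range_ι] at h
  have : PreirreducibleSpace X := by
    refine ⟨fun O₁ O₂ h₁ h₂ hx hy => ?_⟩
    obtain ⟨x, -, hx⟩ := hx
    obtain ⟨y, -, hy⟩ := hy
    obtain ⟨i, hi⟩ := hW x
    obtain ⟨j, hj⟩ := hW y
    -- In the irreducible `W i` the open sets `O₁` and `W j` meet; hence `O₁` and `O₂` both meet the
    -- irreducible `W j`.
    obtain ⟨z, hz1, hz2, hz3⟩ := (hirr i).2 O₁ (W j) h₁ (W j).2 ⟨x, hi, hx⟩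
      ((hne i j).mono fun z hz => hz)
    obtain ⟨w, hw1, hw2, hw3⟩ := (hirr j).2 O₁ O₂ h₁ h₂ ⟨z, hz3, hz2⟩ ⟨y, hj, hy⟩
    exact ⟨w, trivial, hw2, hw3⟩
  have : IrreducibleSpace X := { toNonempty := inferInstance }
  exact isIntegral_of_irreducibleSpace_of_isReduced X

lemma fres_injective [IsIntegral X] {U V : X.Opens} (h : V ≤ U) (hV : (V : Set X).Nonempty) :
    Function.Injective (fres h) := by
  obtain ⟨x, hx⟩ := hV
  intro a b hab
  apply germ_injective_of_isIntegral X x (h hx)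
  have h1 (c : Γ(X, U)) : X.presheaf.germ U x (h hx) c = X.presheaf.germ V x hx (fres h c) :=
    (X.presheaf.germ_res_apply (homOfLE h) x hx c).symm
  rw [h1, h1, hab]

lemma inf_nonempty [IsIntegral X] {U V : X.Opens} (hU : (U : Set X).Nonempty)
    (hV : (V : Set X).Nonempty) : ((U ⊓ V : X.Opens) : Set X).Nonempty :=
  nonempty_preirreducible_inter U.2 V.2 hU hV

end IntegralSchemes

/-! ### The total space is affine over `X` and integral. -/

namespace IsTotalSpace

variable {X V : Scheme.{u}} {π : V ⟶ X} {L : X.Modules}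
  {s : Γ((Scheme.Modules.pullback π).obj L, ⊤)}

lemma exists_coord {U : X.Opens} {e : Γ(L, U)} (he : IsBasis L e) :
    ∃ t : Γ(V, π ⁻¹ᵁ U), mres _ le_top s = t • pb π e :=
  ⟨(he.pb π).coord (mres _ le_top s), ((he.pb π).coord_smul _).symm⟩

variable (hV : IsTotalSpace π L s) (hL : IsLineBundle L)
include hV hL

lemma isAffineHom : IsAffineHom π := by
  refine isAffineHom_of_forall_exists_isAffineOpen π fun x => ?_
  obtain ⟨U, e, hx, he⟩ := hL.exists_isBasis x
  obtain ⟨W, hW, hxW, hWU⟩ := exists_isAffineOpen_mem_and_subset hx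
  refine ⟨W, hxW, hW, ?_⟩
  obtain ⟨t, ht⟩ := exists_coord (π := π) (s := s) (he.restrict (show W ≤ U from hWU))
  obtain ⟨h, h1, h2⟩ := hV.exists_isIso (he.restrict _) ht
  have : IsAffine W := hW
  exact IsAffine.of_isIso h

/-- Affine lines over the trivializing opens of `L` cover `V`. They are integral, and they meet
pairwise because those opens do. -/
lemma isIntegral [IsIntegral X] : IsIntegral V := by
  choose U e hx he using hL.exists_isBasis
  choose t ht using fun x => exists_coord (π := π) (s := s) (he x)
  choose h h1 h2 using fun x => hV.exists_isIso (he x) (ht x)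
  have hne (x y : X) : (((π ⁻¹ᵁ U x) ⊓ (π ⁻¹ᵁ U y) : V.Opens) : Set V).Nonempty := by
    have h3 := inf_nonempty ⟨x, hx x⟩ ⟨y, hx y⟩
    obtain ⟨t', ht'⟩ := exists_coord (π := π) (s := s) ((he x).restrict
      (inf_le_left : U x ⊓ U y ≤ U x))
    exact hV.preimage_nonempty ((he x).restrict inf_le_left) ht' h3
  have : Nonempty V := by
    obtain ⟨x⟩ : Nonempty X := inferInstance
    exact ⟨(hne x x).some⟩
  refine isIntegral_of_cover (fun x => π ⁻¹ᵁ U x) (fun v => ⟨π v, hx _⟩) (fun x => ?_) hne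
  have : Nonempty (U x) := ⟨⟨x, hx x⟩⟩
  have : IsIntegral (U x).toScheme := inferInstance
  have := h1 x
  have : Nonempty (π ⁻¹ᵁ U x) := ⟨⟨_, (hne x x).some_mem.1⟩⟩
  exact isIntegral_of_isOpenImmersion (h x)

end IsTotalSpace

lemma IsProjective.quasiSeparatedSpace {k : Type u} [Field k] {X : Scheme.{u}}
    [X.Over (Spec (CommRingCat.of k))] (h : IsProjective k X) : QuasiSeparatedSpace X := by
  obtain ⟨N, i, hi, -⟩ := h
  exact quasiSeparatedSpace_of_quasiSeparated i

/-! ### Tensor products and powers in terms of bases. -/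

section Tensor

open scoped TensorProduct

variable {X : Scheme.{u}} (M N : X.Modules)

/-- The presheaf tensor product. -/
def tensorPresheaf : PresheafOfModules X.ringCatSheaf.obj :=
  PresheafOfModules.Monoidal.tensorObj (R := X.presheaf) M.val N.val

/-- The map from the tensor product of the sections to the sections of the tensor product. -/
def tensorUnit (U : X.Opens) : (Γ(M, U) ⊗[Γ(X, U)] Γ(N, U)) →ₗ[Γ(X, U)] Γ(tensor M N, U) :=
  ((PresheafOfModules.toSheafify (𝟙 X.ringCatSheaf.obj)
    (CategoryTheory.toSheafify (Opens.grothendieckTopology X)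
      (tensorPresheaf M N).presheaf)).app (.op U)).hom

variable {M N} {U : X.Opens}

/-- The tensor product of two sections. -/
def tmul (m : Γ(M, U)) (n : Γ(N, U)) : Γ(tensor M N, U) := tensorUnit M N U (m ⊗ₜ n)

lemma tmul_smul_smul (a b : Γ(X, U)) (m : Γ(M, U)) (n : Γ(N, U)) :
    tmul (a • m) (b • n) = (a * b) • tmul m n := by
  rw [tmul, TensorProduct.smul_tmul_smul, map_smul, tmul]

lemma mres_tmul {V : X.Opens} (h : V ≤ U) (m : Γ(M, U)) (n : Γ(N, U)) :
    mres _ h (tmul m n) = tmul (mres M h m) (mres N h n) :=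
  congr($((CategoryTheory.toSheafify (Opens.grothendieckTopology X)
    (tensorPresheaf M N).presheaf).naturality (homOfLE h).op) (m ⊗ₜ n)).symm

/-- Local surjectivity of the map from a presheaf to its sheafification; its local injectivity gives
`exists_tmul_eq_tmul`. -/
lemma exists_tensorUnit_eq (z : Γ(tensor M N, U)) {x : X} (hx : x ∈ U) :
    ∃ (V : X.Opens) (h : V ≤ U) (y : Γ(M, V) ⊗[Γ(X, V)] Γ(N, V)),
      x ∈ V ∧ mres _ h z = tensorUnit M N V y := by
  obtain ⟨V, i, ⟨y, hy⟩, hxV⟩ := Presheaf.imageSieve_mem (Opens.grothendieckTopology X)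
    (CategoryTheory.toSheafify (Opens.grothendieckTopology X) (tensorPresheaf M N).presheaf) z x hx
  exact ⟨V, i.le, y, hxV, hy.symm⟩

lemma exists_tmul_eq_tmul (m m' : Γ(M, U)) (n n' : Γ(N, U)) (hy : tmul m n = tmul m' n') {x : X}
    (hx : x ∈ U) : ∃ (V : X.Opens) (h : V ≤ U), x ∈ V ∧
      mres M h m ⊗ₜ[Γ(X, V)] mres N h n = mres M h m' ⊗ₜ[Γ(X, V)] mres N h n' := by
  obtain ⟨V, i, hi, hxV⟩ := Presheaf.equalizerSieve_mem (Opens.grothendieckTopology X)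
    (CategoryTheory.toSheafify (Opens.grothendieckTopology X) (tensorPresheaf M N).presheaf)
    (show Γ(M, U) ⊗[Γ(X, U)] Γ(N, U) from m ⊗ₜ n) (show Γ(M, U) ⊗[Γ(X, U)] Γ(N, U) from m' ⊗ₜ n')
    hy x hx
  exact ⟨V, i.le, hxV, hi⟩

/-- The coordinate in a basis, as a linear map. -/
def IsBasis.coordₗ {e : Γ(M, U)} (he : IsBasis M e) : Γ(M, U) →ₗ[Γ(X, U)] Γ(X, U) where
  toFun := he.coord
  map_add' m n := he.coord_eq (by rw [add_smul, he.coord_smul, he.coord_smul])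
  map_smul' a m := he.coord_eq (by rw [RingHom.id_apply, smul_eq_mul, mul_smul, he.coord_smul])

/-- Before sheafification the tensor product is free on `e ⊗ f` over every open subset of `U`. Local
injectivity keeps coefficients unique; local surjectivity gives local coefficients, which glue by
uniqueness. -/
lemma IsBasis.tmul {e : Γ(M, U)} (he : IsBasis M e) {f : Γ(N, U)} (hf : IsBasis N f) :
    IsBasis _ (tmul e f) := by
  have span (W : X.Opens) (hW : W ≤ U) (y : Γ(M, W) ⊗[Γ(X, W)] Γ(N, W)) :
      ∃ a : Γ(X, W), y = a • (mres M hW e ⊗ₜ mres N hW f) := by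
    induction y with
    | zero => exact ⟨0, by simp⟩
    | tmul m n =>
      refine ⟨(he.restrict hW).coord m * (hf.restrict hW).coord n, ?_⟩
      rw [← TensorProduct.smul_tmul_smul, coord_smul, coord_smul]
    | add y z hy hz =>
      obtain ⟨a, rfl⟩ := hy
      obtain ⟨b, rfl⟩ := hz
      exact ⟨a + b, (add_smul _ _ _).symm⟩
  have inj (W : X.Opens) (hW : W ≤ U) {a b : Γ(X, W)}
      (h : (a • mres M hW e) ⊗ₜ[Γ(X, W)] mres N hW f =
        (b • mres M hW e) ⊗ₜ[Γ(X, W)] mres N hW f) : a = b := by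
    have := congrArg (TensorProduct.lift ((LinearMap.mul Γ(X, W) Γ(X, W)).compl₁₂
      (he.restrict hW).coordₗ (hf.restrict hW).coordₗ)) h
    have h1 (c : Γ(X, W)) : (he.restrict hW).coordₗ (c • mres M hW e) = c :=
      (he.restrict hW).coord_eq rfl
    have h2 : (hf.restrict hW).coordₗ (mres N hW f) = 1 :=
      (hf.restrict hW).coord_eq (one_smul _ _)
    simpa only [TensorProduct.lift.tmul, LinearMap.compl₁₂_apply, h1, h2, LinearMap.mul_apply',
      mul_one] using this
  have binj (W : X.Opens) (hW : W ≤ U) :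
      Function.Injective (fun a : Γ(X, W) => a • mres _ hW (BondalSpiral.tmul e f)) := by
    intro a b hab
    have h1 (c : Γ(X, W)) : c • mres _ hW (BondalSpiral.tmul e f) =
        BondalSpiral.tmul (c • mres M hW e) (mres N hW f) := by
      conv_rhs => rw [← one_smul Γ(X, W) (mres N hW f), tmul_smul_smul, mul_one]
      rw [mres_tmul]
    simp only [h1] at hab
    refine function_ext fun x hx => ?_
    obtain ⟨V, h, hxV, hV⟩ := exists_tmul_eq_tmul _ _ _ _ hab hx
    refine ⟨V, h, hxV, inj V (h.trans hW) ?_⟩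
    simpa only [mres_smul, mres_mres] using hV
  intro W hW
  refine ⟨binj W hW, fun z => ?_⟩
  have : ∀ x : W, ∃ (V : X.Opens) (h : V ≤ W) (a : Γ(X, V)), x.1 ∈ V ∧
      mres _ h z = a • mres _ (h.trans hW) (BondalSpiral.tmul e f) := by
    intro x
    obtain ⟨V, h, y, hxV, hy⟩ := exists_tensorUnit_eq z x.2
    obtain ⟨a, rfl⟩ := span V (h.trans hW) y
    refine ⟨V, h, a, hxV, ?_⟩
    rw [hy, map_smul, mres_tmul]
    rfl
  choose V h a hx ha using this
  obtain ⟨b, hb⟩ := function_glue V h (fun x hx' => ⟨⟨x, hx'⟩, hx _⟩) a (fun x y => by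
    apply binj _ (inf_le_left.trans ((h x).trans hW))
    have h1 := congrArg (mres _ (inf_le_left : V x ⊓ V y ≤ V x)) (ha x)
    have h2 := congrArg (mres _ (inf_le_right : V x ⊓ V y ≤ V y)) (ha y)
    simp only [mres_smul, mres_mres] at h1 h2
    exact h1.symm.trans h2)
  refine ⟨b, section_ext fun x hx' => ⟨V ⟨x, hx'⟩, h _, hx _, ?_⟩⟩
  rw [mres_smul, hb, mres_mres, ha]

/-- The powers of a section. -/
def tpow (e : Γ(M, U)) : ∀ d : ℕ, Γ(tensorPow M d, U)
  | 0 => (1 : Γ(X, U))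
  | d + 1 => tmul (tpow e d) e

lemma IsBasis.tpow {e : Γ(M, U)} (he : IsBasis M e) : ∀ d, IsBasis _ (tpow e d)
  | 0 => by
    have := isBasis_one.restrict (le_top : U ≤ ⊤)
    have h1 : mres (structureSheaf X) (le_top : U ≤ ⊤) (1 : Γ(X, ⊤)) = (1 : Γ(X, U)) :=
      map_one (fres le_top)
    rw [h1] at this
    exact this
  | d + 1 => (he.tpow d).tmul he

lemma tpow_smul (a : Γ(X, U)) (e : Γ(M, U)) : ∀ d, tpow (a • e) d = a ^ d • tpow e d
  | 0 => by rw [pow_zero, one_smul]; rfl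
  | d + 1 => by rw [tpow, tpow_smul a e d, tmul_smul_smul, pow_succ]; rfl

lemma mres_tpow {V : X.Opens} (h : V ≤ U) (e : Γ(M, U)) :
    ∀ d, mres _ h (tpow e d) = tpow (mres M h e) d
  | 0 => map_one (fres h)
  | d + 1 => (mres_tmul h _ _).trans (by rw [mres_tpow h e d]; rfl)

end Tensor

/-! ### Morphisms from the structure sheaf and the locus where they generate. -/

section GeneratingLocus

variable {X : Scheme.{u}} {M : X.Modules}

/-- The global section that corresponds to a morphism from the structure sheaf. -/
def sectionOfHom (s : structureSheaf X ⟶ M) : Γ(M, ⊤) := s.app ⊤ (1 : Γ(X, ⊤))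

lemma app_eq_smul (s : structureSheaf X ⟶ M) {U : X.Opens} (a : Γ(X, U)) :
    s.app U a = a • mres M le_top (sectionOfHom s) := by
  have h1 : mres (structureSheaf X) (le_top : U ≤ ⊤) (1 : Γ(X, ⊤)) = (1 : Γ(X, U)) :=
    map_one (fres le_top)
  have h2 := app_mres s (le_top : U ≤ ⊤) (show Γ(structureSheaf X, ⊤) from (1 : Γ(X, ⊤)))
  have h3 := app_smul s a (mres (structureSheaf X) (le_top : U ≤ ⊤) (1 : Γ(X, ⊤)))
  have h4 : a • mres (structureSheaf X) (le_top : U ≤ ⊤) (1 : Γ(X, ⊤)) = a := by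
    rw [h1]
    exact mul_one a
  rw [h4] at h3
  exact h3.trans (congrArg (a • ·) h2)

lemma isIso_restrict_iff_isBasis (s : structureSheaf X ⟶ M) (U : X.Opens) :
    IsIso ((Scheme.Modules.restrictFunctor U.ι).map s) ↔
      IsBasis M (mres M (le_top : U ≤ ⊤) (sectionOfHom s)) := by
  rw [Scheme.Modules.Hom.isIso_iff_isIso_app]
  have key (W : U.toScheme.Opens) :
      IsIso (((Scheme.Modules.restrictFunctor U.ι).map s).app W) ↔
        Function.Bijective (fun a : Γ(X, U.ι ''ᵁ W) =>
          a • mres M (le_top : U.ι ''ᵁ W ≤ ⊤) (sectionOfHom s)) := by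
    rw [ConcreteCategory.isIso_iff_bijective]
    have : ⇑(((Scheme.Modules.restrictFunctor U.ι).map s).app W) =
        (fun a : Γ(X, U.ι ''ᵁ W) => a • mres M (le_top : U.ι ''ᵁ W ≤ ⊤) (sectionOfHom s)) :=
      funext fun a => app_eq_smul s (U := U.ι ''ᵁ W) a
    rw [this]
    rfl
  simp only [key]
  constructor
  · intro h W hW
    obtain ⟨W', rfl⟩ : ∃ W', U.ι ''ᵁ W' = W :=
      ⟨U.ι ⁻¹ᵁ W, (U.ι.image_preimage_eq_opensRange_inf W).trans
        (by rw [Scheme.Opens.opensRange_ι]; exact inf_eq_right.2 hW)⟩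
    simpa only [mres_mres] using h W'
  · intro h W
    have hW : U.ι ''ᵁ W ≤ U := (U.ι.image_le_opensRange W).trans_eq U.opensRange_ι
    simpa only [mres_mres] using h _ hW

end GeneratingLocus

/-! ### Dual bases of a line bundle and its inverse. -/

section Dual

variable {X : Scheme.{u}} {L L' : X.Modules} (θ : tensor L L' ≅ structureSheaf X) {U : X.Opens}

/-- The pairing of sections of `L` and of its inverse. -/
def pairing (e : Γ(L, U)) (e' : Γ(L', U)) : Γ(X, U) := θ.hom.app U (tmul e e')

lemma pairing_smul_smul (a b : Γ(X, U)) (e : Γ(L, U)) (e' : Γ(L', U)) :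
    pairing θ (a • e) (b • e') = a * b * pairing θ e e' := by
  rw [pairing, tmul_smul_smul, app_smul]
  rfl

lemma fres_pairing {V : X.Opens} (h : V ≤ U) (e : Γ(L, U)) (e' : Γ(L', U)) :
    fres h (pairing θ e e') = pairing θ (mres L h e) (mres L' h e') := by
  rw [pairing, pairing, ← mres_tmul]
  exact (app_mres θ.hom h _).symm

/-- The isomorphism `θ` takes the basis `e ⊗ e'` to a basis of the structure sheaf, that is, to a
unit; `e'` is divided by it. -/
lemma IsBasis.exists_dual {e : Γ(L, U)} (he : IsBasis L e) {e' : Γ(L', U)} (he' : IsBasis L' e') :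
    ∃ e'' : Γ(L', U), IsBasis L' e'' ∧ pairing θ e e'' = 1 := by
  obtain ⟨a, ha⟩ := ((he.tmul he').map_iso θ).bijective.2 (1 : Γ(X, U))
  have ha' : a * pairing θ e e' = 1 := ha
  refine ⟨a • e', he'.unit_smul (Units.mkOfMulEqOne a _ ha'), ?_⟩
  rw [← one_smul Γ(X, U) e, pairing_smul_smul, one_mul, ha']

end Dual

/-! ### Sections of powers of the inverse of `L` as functions on `V`. -/

namespace IsTotalSpace

variable {X V : Scheme.{u}} {π : V ⟶ X} {L L' : X.Modules}
  {s : Γ((Scheme.Modules.pullback π).obj L, ⊤)} (θ : tensor L L' ≅ structureSheaf X)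

/-- Data over an open set that express a section of a power of the inverse of `L` as a
homogeneous function on the total space: dual bases, the fibre coordinate, the coordinate of
the section. -/
structure LocalData (π : V ⟶ X) (s : Γ((Scheme.Modules.pullback π).obj L, ⊤))
    (θ : tensor L L' ≅ structureSheaf X) {d : ℕ} (σ : Γ(tensorPow L' d, ⊤)) (U : X.Opens) where
  e : Γ(L, U)
  e' : Γ(L', U)
  t : Γ(V, π ⁻¹ᵁ U)
  h : Γ(X, U)
  basis : IsBasis L e
  basis' : IsBasis L' e'
  dual : pairing θ e e' = 1
  coord : mres _ le_top s = t • pb π e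
  section_eq : mres _ le_top σ = h • tpow e' d

namespace LocalData

variable {θ} {d : ℕ} {σ : Γ(tensorPow L' d, ⊤)} {U W : X.Opens}

lemma exists_mem (hL : IsLineBundle L) (hL' : IsLineBundle L') (x : X) :
    ∃ U : X.Opens, x ∈ U ∧ Nonempty (LocalData π s θ σ U) := by
  obtain ⟨U₁, e₁, hx₁, he₁⟩ := hL.exists_isBasis x
  obtain ⟨U₂, e₂, hx₂, he₂⟩ := hL'.exists_isBasis x
  have he := he₁.restrict (inf_le_left : U₁ ⊓ U₂ ≤ U₁)
  obtain ⟨e', he', hd⟩ := he.exists_dual θ (he₂.restrict (inf_le_right : U₁ ⊓ U₂ ≤ U₂))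
  obtain ⟨t, ht⟩ := exists_coord (π := π) (s := s) he
  exact ⟨U₁ ⊓ U₂, ⟨hx₁, hx₂⟩, ⟨⟨_, e', t, (he'.tpow d).coord (mres _ le_top σ), he, he', hd, ht,
    ((he'.tpow d).coord_smul _).symm⟩⟩⟩

/-- Restriction of local data. -/
def restrict (D : LocalData π s θ σ U) (hW : W ≤ U) : LocalData π s θ σ W where
  e := mres _ hW D.e
  e' := mres _ hW D.e'
  t := fres (π.preimage_mono hW) D.t
  h := fres hW D.h
  basis := D.basis.restrict hW
  basis' := D.basis'.restrict hW
  dual := by rw [← fres_pairing, D.dual, map_one]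
  coord := by
    have := congrArg (mres _ (π.preimage_mono hW)) D.coord
    rwa [mres_mres, mres_smul, ← pb_mres] at this
  section_eq := by
    have := congrArg (mres _ hW) D.section_eq
    rwa [mres_mres, mres_smul, mres_tpow] at this

/-- The homogeneous function on the total space. -/
def function (D : LocalData π s θ σ U) : Γ(V, π ⁻¹ᵁ U) := π.app U D.h * D.t ^ d

lemma function_restrict (D : LocalData π s θ σ U) (hW : W ≤ U) :
    (D.restrict hW).function = fres (π.preimage_mono hW) D.function := by
  simp only [function, restrict, map_mul, map_pow, app_fres]

/-- When `e` is multiplied by a unit `v`, both `e'` and `t` are multiplied by `v⁻¹` and `h` by `v ^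
d`, so `h * t ^ d` stays the same. -/
lemma function_eq (D₁ D₂ : LocalData π s θ σ U) : D₁.function = D₂.function := by
  obtain ⟨v, hv⟩ := D₁.basis.exists_unit D₂.basis
  obtain ⟨w, hw⟩ := D₁.basis'.exists_unit D₂.basis'
  have hvw : (v * w : Γ(X, U)) = 1 := by
    have := D₂.dual
    rwa [hv, hw, pairing_smul_smul, D₁.dual, mul_one] at this
  have h1 : D₁.t = D₂.t * π.app U v := by
    apply (D₁.basis.pb π).smul_injective
    rw [← D₁.coord, D₂.coord, hv, pb_smul, mul_smul]
  have h2 : D₁.h = D₂.h * (w : Γ(X, U)) ^ d := by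
    apply (D₁.basis'.tpow d).smul_injective
    rw [← D₁.section_eq, D₂.section_eq, hw, tpow_smul, mul_smul]
  rw [function, function, h1, h2, map_mul, map_pow, mul_pow]
  have h3 : (π.app U w : Γ(V, π ⁻¹ᵁ U)) ^ d * π.app U v ^ d = 1 := by
    rw [← mul_pow, ← map_mul, mul_comm, hvw, map_one, one_pow]
  linear_combination (π.app U D₂.h * D₂.t ^ d) * h3

end LocalData

variable (π s) in
/-- A section of a power of the inverse of `L` is a function on the total space. -/
lemma exists_function (hL : IsLineBundle L) (hL' : IsLineBundle L') {d : ℕ}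
    (σ : Γ(tensorPow L' d, ⊤)) :
    ∃ f : Γ(V, ⊤), ∀ (U : X.Opens) (D : LocalData π s θ σ U), fres le_top f = D.function := by
  choose U hx D using LocalData.exists_mem (π := π) (s := s) (θ := θ) (σ := σ) hL hL'
  obtain ⟨f, hf⟩ := function_glue (U := (⊤ : V.Opens)) (fun x : X => π ⁻¹ᵁ U x)
    (fun x => le_top) (fun v _ => ⟨π v, hx _⟩) (fun x => (D x).some.function) (fun x y => by
      have h1 := (D x).some.function_restrict (inf_le_left : U x ⊓ U y ≤ U x)
      have h2 := (D y).some.function_restrict (inf_le_right : U x ⊓ U y ≤ U y)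
      rw [LocalData.function_eq _ ((D y).some.restrict inf_le_right)] at h1
      exact h1.symm.trans h2)
  refine ⟨f, fun W E => function_ext fun v hv => ⟨π ⁻¹ᵁ (W ⊓ U (π v)),
    π.preimage_mono inf_le_left, ⟨hv, hx _⟩, ?_⟩⟩
  have h1 := congrArg (fres (π.preimage_mono (inf_le_right : W ⊓ U (π v) ≤ U (π v)))) (hf (π v))
  rw [fres_fres, ← LocalData.function_restrict _ inf_le_right] at h1
  rw [fres_fres, ← LocalData.function_restrict _ inf_le_left, h1]
  exact LocalData.function_eq _ _

variable (hV : IsTotalSpace π L s)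
include hV

/-- If the inverse of `L` is ample, then some affine non-empty open set of the total space is
the non-vanishing locus of a global function. -/
theorem exists_isAffineOpen_basicOpen [IsIntegral X] (hL : IsAntiAmple L) :
    ∃ f : Γ(V, ⊤), f ≠ 0 ∧ IsAffineOpen (V.basicOpen f) := by
  obtain ⟨hL, L', ⟨θ⟩, hL', -, hample⟩ := hL
  obtain ⟨x⟩ : Nonempty X := inferInstance
  obtain ⟨d, -, s', hx, haff⟩ := hample x
  obtain ⟨f, hf⟩ := exists_function π s θ hL hL' (sectionOfHom s')
  have := hV.isAffineHom hL
  have := hV.isIntegral hL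
  refine ⟨f, ?_, ?_⟩
  -- Near `x` the section generates, so its coordinate is a unit, and the fibre coordinate is
  -- non-zero on the integral `V`; so `f ≠ 0`.
  · rintro rfl
    obtain ⟨Y, hY, hxY⟩ := Opens.mem_sSup.1 hx
    obtain ⟨U, hxU, ⟨D⟩⟩ := LocalData.exists_mem (π := π) (s := s) (θ := θ)
      (σ := sectionOfHom s') hL hL' x
    let E := D.restrict (inf_le_right : Y ⊓ U ≤ U)
    have hne : ((Y ⊓ U : X.Opens) : Set X).Nonempty := ⟨x, hxY, hxU⟩
    have h1 := hf _ E
    have hb := ((isIso_restrict_iff_isBasis s' Y).1 hY).restrict (inf_le_left : Y ⊓ U ≤ Y)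
    rw [mres_mres] at hb
    obtain ⟨w, hw⟩ := (E.basis'.tpow d).exists_unit hb
    have hE : E.h = w := (E.basis'.tpow d).smul_injective (by rw [← E.section_eq, ← hw])
    have ht := hV.ne_zero E.basis E.coord hne
    have : Nonempty (π ⁻¹ᵁ (Y ⊓ U) : V.Opens) :=
      (hV.preimage_nonempty E.basis E.coord hne).to_subtype
    rw [map_zero, LocalData.function, hE] at h1
    exact mul_ne_zero ((w.isUnit.map (π.app (Y ⊓ U)).hom).ne_zero) (pow_ne_zero d ht) h1.symm
  -- Where `h * t ^ d` does not vanish, `h` is invertible and `s'` generates. So the locus `f ≠ 0`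
  -- is a basic open subset of the preimage of an affine open under the affine morphism `π`.
  · have hle : V.basicOpen f ≤ π ⁻¹ᵁ generatingLocus s' := by
      intro v hv
      obtain ⟨U, hxU, ⟨D⟩⟩ := LocalData.exists_mem (π := π) (s := s) (θ := θ)
        (σ := sectionOfHom s') hL hL' (π v)
      have h1 : v ∈ V.basicOpen (fres (le_top : π ⁻¹ᵁ U ≤ ⊤) f) := by
        rw [show V.basicOpen (fres (le_top : π ⁻¹ᵁ U ≤ ⊤) f) = π ⁻¹ᵁ U ⊓ V.basicOpen f from
          V.basicOpen_res _ _]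
        exact ⟨hxU, hv⟩
      rw [hf U D, LocalData.function, Scheme.basicOpen_mul, ← Scheme.preimage_basicOpen] at h1
      refine (le_sSup ?_ : X.basicOpen D.h ≤ generatingLocus s') h1.1
      change IsIso _
      rw [isIso_restrict_iff_isBasis]
      let E := D.restrict (X.basicOpen_le D.h)
      have hu : IsUnit E.h := RingedSpace.isUnit_res_basicOpen _ D.h
      have := (E.basis'.tpow d).unit_smul hu.unit
      rwa [hu.unit_spec, ← E.section_eq] at this
    have h2 := (haff.preimage π).basicOpen (fres (le_top : π ⁻¹ᵁ generatingLocus s' ≤ ⊤) f)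
    rw [show V.basicOpen (fres (le_top : π ⁻¹ᵁ generatingLocus s' ≤ ⊤) f) = _ from
      V.basicOpen_res _ _] at h2
    rwa [inf_eq_right.2 hle] at h2

end IsTotalSpace

/-! ### Local functions as fractions of global ones. -/

section Fractions

variable {V : Scheme.{u}}

/-- Every local function is a quotient of global functions. -/
def HasGlobalFractions (V : Scheme.{u}) : Prop :=
  ∀ (W : V.Opens), (W : Set V).Nonempty → ∀ q : Γ(V, W), ∃ a b : Γ(V, ⊤),
    b ≠ 0 ∧ fres le_top b * q = fres le_top a

lemma exists_pow_mul_eq [CompactSpace V] [QuasiSeparatedSpace V] (f : Γ(V, ⊤))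
    (x : Γ(V, V.basicOpen f)) :
    ∃ (n : ℕ) (y : Γ(V, ⊤)), fres le_top y = fres le_top f ^ n * x :=
  exists_eq_pow_mul_of_isCompact_of_isQuasiSeparated V ⊤ isCompact_univ isQuasiSeparated_univ f x

lemma basicOpen_fres {U W : V.Opens} (h : W ≤ U) (f : Γ(V, U)) :
    V.basicOpen (fres h f) = W ⊓ V.basicOpen f :=
  V.basicOpen_res f (homOfLE h).op

/-- If the non-vanishing locus of a non-zero global function is affine, then
local functions are quotients of global functions. -/
lemma hasGlobalFractions [IsIntegral V] [CompactSpace V] [QuasiSeparatedSpace V] {f : Γ(V, ⊤)}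
    (hf : f ≠ 0) (haff : IsAffineOpen (V.basicOpen f)) : HasGlobalFractions V := by
  intro W hW q
  have hne : (V.basicOpen f : Set V).Nonempty := by
    rw [Set.nonempty_iff_ne_empty]
    intro h
    exact hf ((basicOpen_eq_bot_iff f).1 (Opens.ext h))
  obtain ⟨v, hvW, hvf⟩ := inf_nonempty hW hne
  obtain ⟨g, hgW, hvg⟩ := haff.exists_basicOpen_le ⟨v, hvW⟩ hvf
  -- After multiplication by a power of `f`, the function `g` extends to a global `g'`. Since `f *
  -- g'` vanishes off the locus `g ≠ 0`, that locus, which lies inside `W`, is a basic open set of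
  -- `V`, and the same extension argument applies to `q`.
  obtain ⟨n, g', hg'⟩ := exists_pow_mul_eq f g
  have hG : V.basicOpen (f * g') = V.basicOpen g := by
    have h1 := basicOpen_fres (le_top : V.basicOpen f ≤ ⊤) g'
    have hu : IsUnit (fres (le_top : V.basicOpen f ≤ ⊤) f ^ n) :=
      (RingedSpace.isUnit_res_basicOpen V.toRingedSpace f).pow n
    rw [hg', Scheme.basicOpen_mul, Scheme.basicOpen_of_isUnit _ hu,
      inf_eq_right.2 (V.basicOpen_le g)] at h1
    rw [Scheme.basicOpen_mul, h1]
  have hle : V.basicOpen (f * g') ≤ W := hG ▸ hgW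
  have hv : v ∈ V.basicOpen (f * g') := hG ▸ hvg
  obtain ⟨m, a, ha⟩ := exists_pow_mul_eq (f * g') (fres hle q)
  refine ⟨a, (f * g') ^ m, pow_ne_zero _ ?_, ?_⟩
  · intro h0
    rw [h0] at hv
    simp at hv
  · apply fres_injective hle ⟨v, hv⟩
    rw [map_mul, fres_fres, fres_fres, map_pow, ha]

end Fractions

/-! ### Morphisms between line bundles with prescribed generic values. -/

section Homs

variable {X : Scheme.{u}} {M N : X.Modules}

/-- A morphism of sheaves of modules from its values on sections. -/
def homMk (F : ∀ U : X.Opens, Γ(M, U) → Γ(N, U))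
    (hadd : ∀ U m m', F U (m + m') = F U m + F U m')
    (hsmul : ∀ (U : X.Opens) (a : Γ(X, U)) m, F U (a • m) = a • F U m)
    (hres : ∀ (U W : X.Opens) (h : W ≤ U) m, F W (mres M h m) = mres N h (F U m)) : M ⟶ N :=
  Scheme.Modules.fullyFaithfulToPresheafOfModules.preimage (
    { app := fun U => ModuleCat.ofHom
        { toFun := F U.unop
          map_add' := hadd U.unop
          map_smul' := hsmul U.unop }
      naturality := fun {U W} i => by
        ext m
        exact hres U.unop W.unop i.unop.le m } : M.val ⟶ N.val)

lemma homMk_app (F : ∀ U : X.Opens, Γ(M, U) → Γ(N, U)) (hadd hsmul hres) (U : X.Opens)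
    (m : Γ(M, U)) : (homMk F hadd hsmul hres).app U m = F U m := rfl

lemma mres_injective [IsIntegral X] (hN : IsLineBundle N) {U W : X.Opens} (h : W ≤ U)
    (hW : (W : Set X).Nonempty) : Function.Injective (mres N h) := by
  intro n n' hn
  refine section_ext fun x hx => ?_
  obtain ⟨Y, e, hxY, he⟩ := hN.exists_isBasis x
  refine ⟨U ⊓ Y, inf_le_left, ⟨hx, hxY⟩, ?_⟩
  have he' := he.restrict (inf_le_right : U ⊓ Y ≤ Y)
  rw [← he'.coord_smul (mres N _ n), ← he'.coord_smul (mres N _ n')]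
  congr 1
  apply fres_injective (inf_le_inf_right Y h : W ⊓ Y ≤ U ⊓ Y) (inf_nonempty hW ⟨x, hxY⟩)
  rw [he'.fres_coord, he'.fres_coord]
  congr 1
  have := congrArg (mres N (inf_le_left : W ⊓ Y ≤ W)) hn
  simpa only [mres_mres] using this

/-- If every morphism between restrictions to a non-empty open set, given in bases, has
denominators bounded locally, it extends. -/
lemma exists_hom_of_local [IsIntegral X] (hN : IsLineBundle N) {U₀ : X.Opens}
    {m₀ : Γ(M, U₀)} (hm₀ : IsBasis M m₀) (n₀ : Γ(N, U₀)) (hU₀ : (U₀ : Set X).Nonempty)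
    (h : ∀ x : X, ∃ (U : X.Opens) (m : Γ(M, U)) (n : Γ(N, U)), x ∈ U ∧ IsBasis M m ∧
      mres N inf_le_right n =
        (hm₀.restrict (inf_le_left : U₀ ⊓ U ≤ U₀)).coord (mres M inf_le_right m) •
          mres N inf_le_left n₀) :
    ∃ φ : M ⟶ N, φ.app U₀ m₀ = n₀ := by
  choose U m n hx hm hmn using h
  -- The graph of the morphism sought: `b` is the value at `a` of the map `m₀ ↦ n₀`, tested on `U₀ ⊓
  -- W` only. As sections of `N` inject under restriction to non-empty opens, `P` determines `b`,
  -- and linearity and gluing follow from this uniqueness.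
  let P (W : X.Opens) (a : Γ(M, W)) (b : Γ(N, W)) : Prop :=
    mres N (inf_le_right : U₀ ⊓ W ≤ W) b =
      (hm₀.restrict (inf_le_left : U₀ ⊓ W ≤ U₀)).coord (mres M inf_le_right a) •
          mres N inf_le_left n₀
  have P_res {W W' : X.Opens} (h : W' ≤ W) {a b} (hP : P W a b) :
      P W' (mres M h a) (mres N h b) := by
    have := congrArg (mres N (inf_le_inf_left U₀ h : U₀ ⊓ W' ≤ U₀ ⊓ W)) hP
    simpa only [P, mres_mres, mres_smul, IsBasis.fres_coord] using this
  have P_uniq {W : X.Opens} {a b b'} (hb : P W a b) (hb' : P W a b') : b = b' := by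
    refine section_ext fun x hxW => ⟨W, le_rfl, hxW, ?_⟩
    rw [mres_self, mres_self]
    exact mres_injective hN (inf_le_right : U₀ ⊓ W ≤ W) (inf_nonempty hU₀ ⟨x, hxW⟩)
      (hb.trans hb'.symm)
  have P_smul {W : X.Opens} {a b} (c : Γ(X, W)) (hb : P W a b) : P W (c • a) (c • b) := by
    change mres N _ (c • b) = _
    rw [mres_smul, show mres N _ b = _ from hb, smul_smul]
    congr 1
    refine ((IsBasis.coord_eq _ ?_)).symm
    rw [mul_smul, IsBasis.coord_smul, mres_smul]
  have P_add {W : X.Opens} {a b a' b'} (hb : P W a b) (hb' : P W a' b') :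
      P W (a + a') (b + b') := by
    change mres N _ (b + b') = _
    rw [map_add, show mres N _ b = _ from hb, show mres N _ b' = _ from hb', ← add_smul]
    congr 1
    refine ((IsBasis.coord_eq _ ?_)).symm
    rw [add_smul, IsBasis.coord_smul, IsBasis.coord_smul, map_add]
  have P_ex (W : X.Opens) (a : Γ(M, W)) : ∃ b, P W a b := by
    have hloc (x : X) : P (W ⊓ U x) (mres M inf_le_left a)
        (((hm x).restrict (inf_le_right : W ⊓ U x ≤ U x)).coord (mres M inf_le_left a) •
          mres N inf_le_right (n x)) := by
      have h1 := P_smul (((hm x).restrict (inf_le_right : W ⊓ U x ≤ U x)).coord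
        (mres M inf_le_left a)) (P_res (inf_le_right : W ⊓ U x ≤ U x) (hmn x))
      rwa [IsBasis.coord_smul] at h1
    obtain ⟨b, hb⟩ := section_glue (fun x => W ⊓ U x) (fun x => inf_le_left)
      (fun x hxW => ⟨x, hxW, hx x⟩) _ (fun x y => by
        refine P_uniq (P_res _ (hloc x)) ?_
        have := P_res (inf_le_right : (W ⊓ U x) ⊓ (W ⊓ U y) ≤ W ⊓ U y) (hloc y)
        simpa only [mres_mres] using this)
    refine ⟨b, section_ext fun x hxW => ⟨U₀ ⊓ (W ⊓ U x), inf_le_inf_left _ inf_le_left,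
      ⟨hxW.1, hxW.2, hx x⟩, ?_⟩⟩
    have h2 := hloc x
    rw [← hb x] at h2
    simpa only [P, mres_mres, mres_smul, IsBasis.fres_coord] using h2
  choose F hF using P_ex
  refine ⟨homMk F (fun W a a' => P_uniq (hF _ _) (P_add (hF _ _) (hF _ _)))
    (fun W c a => P_uniq (hF _ _) (P_smul c (hF _ _)))
    (fun W W' h a => P_uniq (hF _ _) (P_res h (hF _ _))), ?_⟩
  rw [homMk_app]
  refine P_uniq (hF U₀ m₀) ?_
  have h1 : (hm₀.restrict (inf_le_left : U₀ ⊓ U₀ ≤ U₀)).coord (mres M inf_le_right m₀) = 1 :=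
    IsBasis.coord_eq _ (one_smul _ _)
  change mres N _ n₀ = _
  rw [h1, one_smul]

/-- There are non-zero morphisms between any two line bundles. -/
lemma HasGlobalFractions.exists_hom [IsIntegral X] [CompactSpace X] (hX : HasGlobalFractions X)
    (hM : IsLineBundle M) (hN : IsLineBundle N) {U₀ : X.Opens} {m₀ : Γ(M, U₀)}
    (hm₀ : IsBasis M m₀) {n₀ : Γ(N, U₀)} (hn₀ : IsBasis N n₀) (hU₀ : (U₀ : Set X).Nonempty) :
    ∃ (φ : M ⟶ N) (c : Γ(X, ⊤)), c ≠ 0 ∧ φ.app U₀ m₀ = fres (le_top : U₀ ≤ ⊤) c • n₀ := by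
  classical
  have h : ∀ x : X, ∃ (U : X.Opens) (m : Γ(M, U)) (n : Γ(N, U)) (a b : Γ(X, ⊤)), x ∈ U ∧
      IsBasis M m ∧ b ≠ 0 ∧ mres N inf_le_right (fres (le_top : U ≤ ⊤) a • n) =
        (hm₀.restrict (inf_le_left : U₀ ⊓ U ≤ U₀)).coord (mres M inf_le_right m) •
          mres N inf_le_left (fres (le_top : U₀ ≤ ⊤) b • n₀) := by
    intro x
    obtain ⟨U₁, m, hx₁, hm⟩ := hM.exists_isBasis x
    obtain ⟨U₂, n, hx₂, hn⟩ := hN.exists_isBasis x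
    have hm' := hm.restrict (inf_le_left : U₁ ⊓ U₂ ≤ U₁)
    have hn' := hn.restrict (inf_le_right : U₁ ⊓ U₂ ≤ U₂)
    let W := U₀ ⊓ (U₁ ⊓ U₂)
    obtain ⟨w, hw⟩ := (hn₀.restrict (inf_le_left : W ≤ U₀)).exists_unit
      (hn'.restrict (inf_le_right : W ≤ _))
    -- The function by which the map `m₀ ↦ n₀` is given in the bases `m`, `n` is a fraction `a / b`.
    obtain ⟨a, b, hb, hab⟩ := hX W (inf_nonempty hU₀ ⟨x, hx₁, hx₂⟩)
      ((hm₀.restrict (inf_le_left : W ≤ U₀)).coord (mres M inf_le_right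
        (mres M (inf_le_left : U₁ ⊓ U₂ ≤ U₁) m)) * (w⁻¹ : Γ(X, W)ˣ))
    refine ⟨U₁ ⊓ U₂, _, mres N inf_le_right n, a, b, ⟨hx₁, hx₂⟩, hm', hb, ?_⟩
    rw [mres_smul, hw, mres_smul, fres_fres, fres_fres, ← hab, smul_smul, smul_smul, mul_assoc,
      mul_assoc, Units.inv_mul, mul_one, mul_comm]
  choose U m n a b hx hm hb hmn using h
  obtain ⟨t, ht⟩ := isCompact_univ.elim_finite_subcover (fun x => (U x : Set X))
    (fun x => (U x).2) (fun x _ => Set.mem_iUnion.2 ⟨x, hx x⟩)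
  -- By compactness the product of finitely many denominators `b` is a common denominator.
  obtain ⟨φ, hφ⟩ := exists_hom_of_local hN hm₀ (fres (le_top : U₀ ≤ ⊤) (∏ x ∈ t, b x) • n₀) hU₀ (fun x => by
    obtain ⟨y, hyt, hxy⟩ := Set.mem_iUnion₂.1 (ht (Set.mem_univ x))
    refine ⟨U y, m y, fres (le_top : U y ≤ ⊤) (∏ z ∈ t.erase y, b z) • fres (le_top : U y ≤ ⊤) (a y) • n y, hxy, hm y, ?_⟩
    rw [mres_smul, hmn, mres_smul, mres_smul, ← Finset.mul_prod_erase t b hyt]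
    simp only [map_mul, fres_fres, smul_smul]
    congr 1
    ring)
  exact ⟨φ, _, Finset.prod_ne_zero_iff.2 fun x _ => hb x, hφ⟩

end Homs

/-! ### Torus weights and balanced monomials. -/

section Weights

open Quiver

variable {k : Type u} [Field k] {Q : Type} [Quiver.{u} Q]

/-- The character of the torus by which it acts on a monomial. -/
def weight (d : (Σ a b : Q, (a ⟶ b)) →₀ ℕ) : (Q → kˣ) →* k where
  toFun g := ((d.prod fun e n => (g e.2.1 * (g e.1)⁻¹) ^ n : kˣ) : k)
  map_one' := by simp [Finsupp.prod]
  map_mul' g h := by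
    rw [← Units.val_mul, ← Finsupp.prod_mul]
    congr 2
    funext e n
    rw [← mul_pow]
    congr 1
    rw [Pi.mul_apply, Pi.mul_apply, mul_inv]
    exact mul_mul_mul_comm _ _ _ _

lemma arrowAction_monomial (g : Q → kˣ) (d : (Σ a b : Q, (a ⟶ b)) →₀ ℕ) (c : k) :
    arrowAction g (MvPolynomial.monomial d c) = weight d g • MvPolynomial.monomial d c := by
  rw [arrowAction, MvPolynomial.aeval_monomial, MvPolynomial.monomial_eq, MvPolynomial.smul_eq_C_mul,
    MvPolynomial.algebraMap_eq]
  have : (d.prod fun e n => (MvPolynomial.C ((g e.2.1 * (g e.1)⁻¹ : kˣ) : k) *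
      (MvPolynomial.X e : ArrowPolynomial k Q)) ^ n) =
      MvPolynomial.C (weight d g) * d.prod fun e n => MvPolynomial.X e ^ n := by
    simp only [mul_pow, Finsupp.prod_mul]
    congr 1
    simp [weight, Finsupp.prod, Units.coe_prod]
  rw [this]
  ring

/-- A monomial is balanced if every node occurs as often as a source as it occurs as a target. -/
def IsBalanced (d : (Σ a b : Q, (a ⟶ b)) →₀ ℕ) : Prop :=
  d.mapDomain (fun e => e.2.1) = d.mapDomain (fun e => e.1)

lemma IsBalanced.prod_eq {d : (Σ a b : Q, (a ⟶ b)) →₀ ℕ} (hd : IsBalanced d) {A : Type*}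
    [CommMonoid A] (w : Q → A) :
    (d.prod fun e n => w e.2.1 ^ n) = d.prod fun e n => w e.1 ^ n := by
  have h := congrArg (fun x : Q →₀ ℕ => x.prod fun a n => w a ^ n) hd
  simpa only [Finsupp.prod_mapDomain_index, pow_zero, pow_add, implies_true] using h

/-- Otherwise all units would be roots of unity of one fixed order, and a field has only finitely
many of these. -/
lemma pow_injective_of_infinite [Infinite k] {m n : ℕ} (h : ∀ x : kˣ, x ^ m = x ^ n) : m = n := by
  by_contra hne
  wlog hlt : m < n generalizing m n
  · exact this (fun x => (h x).symm) (Ne.symm hne) (by omega)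
  have : NeZero (n - m) := ⟨by omega⟩
  have h1 : rootsOfUnity (n - m) k = ⊤ := by
    rw [eq_top_iff]
    intro x _
    rw [mem_rootsOfUnity]
    have := h x
    rw [← Nat.sub_add_cancel hlt.le, pow_add] at this
    exact mul_right_cancel (this.symm.trans (one_mul _).symm)
  have h2 : Finite (rootsOfUnity (n - m) k) := inferInstance
  rw [h1] at h2
  have h3 : Finite kˣ := Finite.of_equiv _ Subgroup.topEquiv.toEquiv
  have h4 : (Set.univ : Set k).Finite := by
    refine ((Set.finite_range (Units.val : kˣ → k)).insert 0).subset fun x _ => ?_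
    by_cases hx : x = 0
    · exact Or.inl hx
    · exact Or.inr ⟨Units.mk0 x hx, rfl⟩
  exact Set.infinite_univ h4

/-- The torus element with `x` at the node `a` and `1` elsewhere acts by `x` to the power
(occurrences of `a` as a target minus occurrences as a source). -/
lemma isBalanced_of_weight_eq_one [Infinite k] {d : (Σ a b : Q, (a ⟶ b)) →₀ ℕ}
    (h : weight (k := k) d = 1) : IsBalanced d := by
  classical
  ext a
  refine pow_injective_of_infinite (k := k) fun x => ?_
  have h1 : (d.prod fun e n => ((Pi.mulSingle a x : Q → kˣ) e.2.1 *
      ((Pi.mulSingle a x : Q → kˣ) e.1)⁻¹) ^ n) = 1 :=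
    Units.ext (DFunLike.congr_fun h (Pi.mulSingle a x : Q → kˣ))
  simp only [mul_pow, inv_pow, Finsupp.prod_mul, Finsupp.prod_inv, mul_inv_eq_one] at h1
  have h2 (y : Q →₀ ℕ) : (y.prod fun b n => (Pi.mulSingle a x : Q → kˣ) b ^ n) = x ^ y a := by
    rw [Finsupp.prod, Finset.prod_eq_single a]
    · simp
    · intro b _ hb
      simp [Pi.mulSingle_eq_of_ne hb]
    · intro ha
      simp [Finsupp.notMem_support_iff.1 ha]
  rw [← h2, ← h2, Finsupp.prod_mapDomain_index (by simp) (by simp [pow_add]),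
    Finsupp.prod_mapDomain_index (by simp) (by simp [pow_add])]
  exact h1

/-- An invariant is represented by a combination of balanced monomials. -/
lemma exists_balanced [Infinite k] {I : AdmissibleIdeal k Q} {f : ArrowPolynomial k Q}
    (hf : Ideal.Quotient.mk (representationIdeal I) f ∈ invariants I) :
    ∃ f₀ : ArrowPolynomial k Q, (∀ d ∈ f₀.support, IsBalanced d) ∧
      Ideal.Quotient.mk (representationIdeal I) f₀ = Ideal.Quotient.mk (representationIdeal I) f := by
  classical
  let part (χ : (Q → kˣ) →* k) : ArrowPolynomial k Q :=
    ∑ d ∈ f.support with weight d = χ, MvPolynomial.monomial d (f.coeff d)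
  -- The trivial character is inserted because no monomial of `f` need have weight `1`.
  let S : Finset ((Q → kˣ) →* k) := insert 1 (f.support.image weight)
  have hsum : ∑ χ ∈ S, part χ = f := by
    conv_rhs => rw [f.as_sum]
    refine Finset.sum_fiberwise_of_maps_to (fun d hd => ?_) _
    exact Finset.mem_insert_of_mem (Finset.mem_image_of_mem _ hd)
  have hact (g : Q → kˣ) (χ) : arrowAction g (part χ) = χ g • part χ := by
    rw [map_sum, Finset.smul_sum]
    refine Finset.sum_congr rfl fun d hd => ?_
    rw [arrowAction_monomial, (Finset.mem_filter.1 hd).2]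
  refine ⟨part 1, fun d hd => ?_, ?_⟩
  · obtain ⟨d', hd', h2⟩ := Finset.mem_biUnion.1 (MvPolynomial.support_sum hd)
    rw [Finset.mem_singleton.1 (MvPolynomial.support_monomial_subset h2)]
    exact isBalanced_of_weight_eq_one (Finset.mem_filter.1 hd').2
  · let q : ArrowPolynomial k Q →ₐ[k] RepresentationRing I :=
      Ideal.Quotient.mkₐ k (representationIdeal I)
    change q (part 1) = q f
    have hq (g : Q → kˣ) : ∑ χ ∈ S, χ g • q (part χ) = q f := by
      have h1 : torusAction I g (q f) = q f := (Algebra.mem_iInf.1 hf g)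
      have h2 : torusAction I g (q f) = q (arrowAction g f) := rfl
      rw [← h1, h2]
      conv_rhs => rw [← hsum]
      simp only [map_sum, hact, map_smul]
    -- By `hq`, the sum of `χ g • q (part χ)` is the constant `q f`. A linear functional turns this
    -- into a relation between characters with coefficients in `k`; by their linear independence,
    -- the coefficient of the trivial character gives `q (part 1) = q f`.
    rw [← sub_eq_zero, ← Module.forall_dual_apply_eq_zero_iff k]
    intro ℓ
    have h := linearIndependent_iff'.1 (linearIndependent_monoidHom (Q → kˣ) k) S
      (fun χ => ℓ (q (part χ)) - if χ = 1 then ℓ (q f) else 0) (by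
        funext g
        have := congrArg ℓ (hq g)
        simp only [map_sum, map_smul, smul_eq_mul] at this
        simp only [sub_smul, ite_smul, zero_smul, Finset.sum_sub_distrib, Finset.sum_ite_eq',
          Finset.mem_insert_self, S, if_true]
        simp only [Pi.sub_apply, Finset.sum_apply, Pi.smul_apply, smul_eq_mul, Pi.zero_apply,
          MonoidHom.one_apply, mul_one, sub_eq_zero]
        rw [← this]
        exact Finset.sum_congr rfl fun χ _ => mul_comm _ _) 1 (Finset.mem_insert_self _ _)
    rw [map_sub]
    simpa using h

/-- A combination of balanced monomials does not change its value under a change of bases. -/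
lemma eval₂_eq_of_isBalanced {A : Type*} [CommRing A] {κ : k →+* A}
    {ε ε' : (Σ a b : Q, (a ⟶ b)) → A} (w : Q → Aˣ) (h : ∀ e, ε' e * w e.1 = w e.2.1 * ε e)
    {f : ArrowPolynomial k Q} (hf : ∀ d ∈ f.support, IsBalanced d) :
    f.eval₂ κ ε' = f.eval₂ κ ε := by
  rw [MvPolynomial.eval₂_eq, MvPolynomial.eval₂_eq]
  refine Finset.sum_congr rfl fun d hd => ?_
  congr 1
  have h1 : (d.prod fun e n => (ε' e * w e.1) ^ n) = d.prod fun e n => (w e.2.1 * ε e) ^ n := by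
    simp only [h]
  simp only [mul_pow, Finsupp.prod_mul] at h1
  have h2 := (hf d hd).prod_eq w
  have h3 : (d.prod fun e n => (w e.2.1 : A) ^ n) = d.prod fun e n => (w e.1 : A) ^ n := by
    have := congrArg (Units.val : Aˣ → A) h2
    simpa [Finsupp.prod, Units.coe_prod] using this
  have h4 : IsUnit (d.prod fun e n => (w e.1 : A) ^ n) :=
    ⟨d.prod fun e n => w e.1 ^ n, by simp [Finsupp.prod, Units.coe_prod]⟩
  rw [h3, mul_comm (d.prod fun e n => (w e.1 : A) ^ n)] at h1
  exact h4.mul_left_injective h1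

end Weights

/-! ### Scalars and composition of morphisms. -/

section Constants

variable {k : Type u} [Field k] {V : Scheme.{u}} [V.Over (Spec (CommRingCat.of k))]
  {M N K : V.Modules}

lemma fres_constants {U W : V.Opens} (h : W ≤ U) (c : k) :
    fres h (constants k V U c) = constants k V W c :=
  fres_restrictFunctions h _

lemma constants_smul_app (c : k) (φ : M ⟶ N) (U : V.Opens) (m : Γ(M, U)) :
    (c • φ).app U m = constants k V U c • φ.app U m := by
  refine (smulHom_app (constants k V ⊤ c) φ U m).trans ?_
  rw [restrictFunctions_eq, fres_constants]

lemma constants_smul_comp (c : k) (φ : M ⟶ N) (ψ : N ⟶ K) : (c • φ) ≫ ψ = c • (φ ≫ ψ) :=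
  hom_ext_apply fun U m => by
    rw [constants_smul_app]
    change ψ.app U ((c • φ).app U m) = constants k V U c • ψ.app U (φ.app U m)
    rw [constants_smul_app, app_smul]

lemma comp_constants_smul (c : k) (φ : M ⟶ N) (ψ : N ⟶ K) : φ ≫ (c • ψ) = c • (φ ≫ ψ) :=
  hom_ext_apply fun U m => by
    rw [constants_smul_app]
    exact constants_smul_app c ψ U (φ.app U m)

end Constants

/-! ### Morphisms as functions on the scheme of representations. -/

section PathFunctions

open Quiver

variable {k : Type u} [Field k] {Q : Type} [Quiver.{u} Q]

lemma pathMonomial_comp {a b c : Q} (p : Path a b) (q : Path b c) :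
    pathMonomial (k := k) (p.comp q) = pathMonomial p * pathMonomial q := by
  induction q with
  | nil => simp [pathMonomial]
  | cons q e ih => rw [Path.comp_cons, pathMonomial, pathMonomial, ih, mul_assoc]

lemma pathFunction_eq {a b : Q} (r : Path a b →₀ k) :
    pathFunction r = Finsupp.linearCombination k (pathMonomial (k := k)) r := by
  simp only [pathFunction, Finsupp.linearCombination_apply, MvPolynomial.smul_eq_C_mul]

variable {I : AdmissibleIdeal k Q} {V : Scheme.{u}}
  [V.Over (Spec (CommRingCat.of k))] {E : Q → V.Modules} (Φ : PathAlgebraIso I E)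

/-- The function on the space of representations that corresponds to a morphism `E_b ⟶ E_a`. -/
def bfun (a b : Q) : (E b ⟶ E a) →ₗ[k] RepresentationRing I :=
  (Submodule.liftQ (I.rel a b)
    ((Ideal.Quotient.mkₐ k (representationIdeal I)).toLinearMap ∘ₗ
      Finsupp.linearCombination k (pathMonomial (k := k))) (fun r hr => by
      rw [LinearMap.mem_ker, LinearMap.comp_apply, ← pathFunction_eq]
      exact Ideal.Quotient.eq_zero_iff_mem.2 (Ideal.subset_span ⟨a, b, r, hr, rfl⟩))) ∘ₗ
    (Φ.iso a b).symm.toLinearMap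

lemma bfun_iso {a b : Q} (r : Path a b →₀ k) :
    bfun Φ a b (Φ.iso a b (Submodule.Quotient.mk r)) =
      Ideal.Quotient.mk (representationIdeal I) (pathFunction r) := by
  simp only [bfun, LinearMap.comp_apply, LinearEquiv.coe_coe, LinearEquiv.symm_apply_apply]
  rw [pathFunction_eq]
  exact Submodule.liftQ_apply _ _ _

lemma exists_iso_eq {a b : Q} (φ : E b ⟶ E a) :
    ∃ r : Path a b →₀ k, Φ.iso a b (Submodule.Quotient.mk r) = φ := by
  obtain ⟨x, rfl⟩ := (Φ.iso a b).surjective φ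
  obtain ⟨r, rfl⟩ := Submodule.Quotient.mk_surjective _ x
  exact ⟨r, rfl⟩

lemma pathFunction_single {a b : Q} (p : Path a b) :
    pathFunction (Finsupp.single p (1 : k)) = pathMonomial p := by
  simp [pathFunction]

lemma bfun_arrow {a b : Q} (e : a ⟶ b) :
    bfun Φ a b (Φ.arrow e) =
      Ideal.Quotient.mk (representationIdeal I) (MvPolynomial.X ⟨a, b, e⟩) := by
  rw [PathAlgebraIso.arrow, bfun_iso, pathFunction_single]
  simp [Hom.toPath, pathMonomial]

lemma bfun_id (a : Q) : bfun Φ a a (𝟙 (E a)) = 1 := by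
  rw [← Φ.iso_nil, bfun_iso, pathFunction_single]
  simp [pathMonomial]

/-- Both sides are bilinear, which reduces the claim to single paths: there composition is
concatenation, and the function of a path is the product over its arrows. -/
lemma bfun_comp {a b c : Q} (φ : E c ⟶ E b) (ψ : E b ⟶ E a) :
    bfun Φ a c (φ ≫ ψ) = bfun Φ b c φ * bfun Φ a b ψ := by
  obtain ⟨q, rfl⟩ := exists_iso_eq Φ φ
  obtain ⟨p, rfl⟩ := exists_iso_eq Φ ψ
  induction q using Finsupp.induction_linear with
  | zero => simp
  | add q q' h h' =>
    rw [Submodule.Quotient.mk_add, map_add, Preadditive.add_comp, map_add, map_add, add_mul, h, h']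
  | single q x =>
    induction p using Finsupp.induction_linear with
    | zero => simp
    | add p p' h h' =>
      rw [Submodule.Quotient.mk_add, map_add, Preadditive.comp_add, map_add, map_add, mul_add,
        h, h']
    | single p y =>
      rw [← mul_one x, ← mul_one y, ← smul_eq_mul x, ← smul_eq_mul y, ← Finsupp.smul_single,
        ← Finsupp.smul_single, Submodule.Quotient.mk_smul, Submodule.Quotient.mk_smul,
        map_smul, map_smul, constants_smul_comp, comp_constants_smul, ← Φ.iso_comp, map_smul,
        map_smul, map_smul, map_smul, bfun_iso, bfun_iso, bfun_iso, pathFunction_single,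
        pathFunction_single, pathFunction_single, pathMonomial_comp, map_mul, smul_mul_smul_comm,
        smul_smul, mul_comm (Ideal.Quotient.mk _ _)]

lemma bfun_mem_invariants {a : Q} (φ : E a ⟶ E a) : bfun Φ a a φ ∈ invariants I := by
  obtain ⟨r, rfl⟩ := exists_iso_eq Φ φ
  rw [bfun_iso]
  refine Algebra.mem_iInf.2 fun g => ?_
  change Ideal.Quotient.mk _ (arrowAction g (pathFunction r)) = _
  rw [arrowAction_pathFunction, mul_inv_cancel, Units.val_one, map_one, one_mul]
  rfl

end PathFunctions

/-! ### Evaluation in local frames and the tautological pullback. -/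

section Frames

open Quiver

variable {k : Type u} [Field k] {Q : Type} [Quiver.{u} Q] {I : AdmissibleIdeal k Q}
  {V : Scheme.{u}} [V.Over (Spec (CommRingCat.of k))] {E : Q → V.Modules}
  (Φ : PathAlgebraIso I E) {U W : V.Opens} {m : ∀ a, Γ(E a, U)} (hm : ∀ a, IsBasis (E a) (m a))

/-- The values of the functions on the space of representations on the family that is given by
a local frame. -/
def frameEval : ArrowPolynomial k Q →+* Γ(V, U) :=
  MvPolynomial.eval₂Hom (constants k V U)
    fun e => (hm e.1).coord ((Φ.arrow e.2.2).app U (m e.2.1))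

lemma frameEval_pathMonomial {a b : Q} (p : Path a b) :
    frameEval Φ hm (pathMonomial p) • m a =
      (Φ.iso a b (Submodule.Quotient.mk (Finsupp.single p 1))).app U (m b) := by
  induction p with
  | nil =>
    rw [Φ.iso_nil, pathMonomial, map_one, one_smul]
    rfl
  | @cons b c p e ih =>
    have h := Φ.iso_comp p e.toPath
    rw [Hom.toPath, Path.comp_cons, Path.comp_nil] at h
    rw [h, pathMonomial, map_mul, mul_comm, mul_smul, ih, ← app_smul]
    change _ = (Φ.iso a b _).app U ((Φ.arrow e).app U (m c))
    rw [frameEval, MvPolynomial.coe_eval₂Hom, MvPolynomial.eval₂_X, IsBasis.coord_smul]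

/-- A linear combination of paths evaluates to the matrix entry of the morphism it represents. So
relations evaluate to zero, and evaluation descends to `B`. -/
lemma frameEval_pathFunction {a b : Q} (r : Path a b →₀ k) :
    frameEval Φ hm (pathFunction r) • m a =
      (Φ.iso a b (Submodule.Quotient.mk r)).app U (m b) := by
  induction r using Finsupp.induction_linear with
  | zero =>
    rw [pathFunction_eq, map_zero, map_zero, zero_smul, Submodule.Quotient.mk_zero, map_zero]
    rfl
  | add r r' h h' =>
    rw [pathFunction_eq, map_add, map_add, add_smul, ← pathFunction_eq, ← pathFunction_eq, h, h',
      Submodule.Quotient.mk_add, map_add]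
    rfl
  | single p c =>
    rw [← mul_one c, ← smul_eq_mul c, ← Finsupp.smul_single, Submodule.Quotient.mk_smul,
      map_smul, constants_smul_app, ← frameEval_pathMonomial Φ hm, pathFunction_eq, map_smul,
      ← pathFunction_eq, pathFunction_single, MvPolynomial.smul_eq_C_mul, map_mul, mul_smul]
    congr 1
    exact MvPolynomial.eval₂_C _ _ _

/-- The values of the functions on the scheme of representations on the family that is given by
a local frame. -/
def frameEvalQ : RepresentationRing I →+* Γ(V, U) :=
  Ideal.Quotient.lift _ (frameEval Φ hm) fun f hf => by
    suffices h : representationIdeal I ≤ RingHom.ker (frameEval Φ hm) from h hf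
    refine Ideal.span_le.2 ?_
    rintro _ ⟨a, b, r, hr, rfl⟩
    refine (hm a).smul_injective ?_
    rw [frameEval_pathFunction, (Submodule.Quotient.mk_eq_zero _).2 hr, map_zero, zero_smul]
    rfl

lemma frameEvalQ_mk (f : ArrowPolynomial k Q) :
    frameEvalQ Φ hm (Ideal.Quotient.mk (representationIdeal I) f) = frameEval Φ hm f := rfl

lemma frameEvalQ_bfun {a b : Q} (φ : E b ⟶ E a) :
    frameEvalQ Φ hm (bfun Φ a b φ) • m a = φ.app U (m b) := by
  obtain ⟨r, rfl⟩ := exists_iso_eq Φ φ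
  rw [bfun_iso, frameEvalQ_mk, frameEval_pathFunction]

lemma fres_frameEvalQ (h : W ≤ U) (y : RepresentationRing I) :
    fres h (frameEvalQ Φ hm y) = frameEvalQ Φ (fun a => (hm a).restrict h) y := by
  obtain ⟨f, rfl⟩ := Ideal.Quotient.mk_surjective y
  rw [frameEvalQ_mk, frameEvalQ_mk]
  refine RingHom.congr_fun (f := (fres h).comp (frameEval Φ hm)) ?_ f
  refine MvPolynomial.ringHom_ext (fun c => ?_) fun e => ?_
  · simp [frameEval, fres_constants]
  · simp [frameEval, IsBasis.fres_coord, app_mres]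

/-- The change of frame is a point of the torus with values in `Γ(V, U)`, whereas invariance is
assumed for `k`-points only. A balanced representative is insensitive to both. -/
lemma frameEvalQ_eq [Infinite k] {m' : ∀ a, Γ(E a, U)} (hm' : ∀ a, IsBasis (E a) (m' a))
    (y : invariants I) : frameEvalQ Φ hm' y = frameEvalQ Φ hm y := by
  obtain ⟨y, hy⟩ := y
  obtain ⟨f, rfl⟩ := Ideal.Quotient.mk_surjective y
  obtain ⟨f₀, hf₀, h⟩ := exists_balanced hy
  choose w hw using fun a => (hm a).exists_unit (hm' a)
  rw [Subtype.coe_mk, ← h, frameEvalQ_mk, frameEvalQ_mk]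
  refine eval₂_eq_of_isBalanced w (fun e => ?_) hf₀
  apply (hm e.1).smul_injective
  rw [mul_smul, ← hw, IsBasis.coord_smul, mul_smul, IsBasis.coord_smul, ← app_smul, ← hw]

omit [Quiver.{u} Q] in
lemma exists_frame [Finite Q] (hE : ∀ a, IsLineBundle (E a)) (x : V) :
    ∃ (U : V.Opens) (m : ∀ a, Γ(E a, U)), x ∈ U ∧ ∀ a, IsBasis (E a) (m a) := by
  choose U e hx he using fun a => (hE a).exists_isBasis x
  let U₀ : V.Opens := ⟨⋂ a, (U a : Set V), isOpen_iInter_of_finite fun a => (U a).2⟩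
  have h (a) : U₀ ≤ U a := Set.iInter_subset (fun a => (U a : Set V)) a
  exact ⟨U₀, fun a => mres _ (h a) (e a), Set.mem_iInter.2 hx, fun a => (he a).restrict (h a)⟩

/-- The pullback of invariant functions along the tautological map. -/
lemma exists_tautologicalPullback [Infinite k] [Finite Q] (hE : ∀ a, IsLineBundle (E a)) :
    ∃ τ : invariants I →+* Γ(V, ⊤), ∀ (U : V.Opens) (m : ∀ a, Γ(E a, U))
      (hm : ∀ a, IsBasis (E a) (m a)) (y : invariants I),
      restrictFunctions U (τ y) = frameEvalQ Φ hm y := by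
  have key (y : invariants I) : ∃ t : Γ(V, ⊤), ∀ (U : V.Opens) (m : ∀ a, Γ(E a, U))
      (hm : ∀ a, IsBasis (E a) (m a)), restrictFunctions U t = frameEvalQ Φ hm y := by
    choose U m hx hm using exists_frame hE
    obtain ⟨t, ht⟩ := function_glue (U := ⊤) U (fun _ => le_top) (fun x _ => ⟨x, hx x⟩)
      (fun x => frameEvalQ Φ (hm x) y) fun x x' => by
        rw [fres_frameEvalQ, fres_frameEvalQ]
        exact frameEvalQ_eq _ _ _ _
    refine ⟨t, fun W n hn => function_ext fun x hxW =>
      ⟨W ⊓ U x, inf_le_left, ⟨hxW, hx x⟩, ?_⟩⟩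
    have h := congrArg (fres (inf_le_right : W ⊓ U x ≤ U x)) (ht x)
    rw [fres_restrictFunctions, ← fres_restrictFunctions (inf_le_right : W ⊓ U x ≤ U x)]
    refine h.trans ?_
    rw [fres_frameEvalQ, fres_frameEvalQ]
    exact frameEvalQ_eq _ _ _ _
  choose τ hτ using key
  have uniq {t t' : Γ(V, ⊤)} (h : ∀ (U : V.Opens) (m : ∀ a, Γ(E a, U)),
      (∀ a, IsBasis (E a) (m a)) → restrictFunctions U t = restrictFunctions U t') : t = t' :=
    function_ext fun x _ => by
      obtain ⟨U, m, hx, hm⟩ := exists_frame hE x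
      exact ⟨U, le_top, hx, h U m hm⟩
  refine ⟨⟨⟨⟨τ, ?_⟩, ?_⟩, ?_, ?_⟩, fun U m hm y => hτ y U m hm⟩
  · refine uniq fun U m hm => ?_
    rw [hτ _ U m hm, map_one]
    exact map_one _
  · refine fun y y' => uniq fun U m hm => ?_
    rw [hτ _ U m hm, map_mul, hτ _ U m hm, hτ _ U m hm]
    exact map_mul _ _ _
  · refine uniq fun U m hm => ?_
    change restrictFunctions U (τ 0) = _
    rw [hτ _ U m hm, map_zero]
    exact map_zero _
  · refine fun y y' => uniq fun U m hm => ?_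
    change restrictFunctions U (τ (y + y')) = restrictFunctions U (τ y + τ y')
    rw [hτ _ U m hm, map_add, hτ _ U m hm, hτ _ U m hm]
    exact map_add _ _ _

variable {τ : invariants I →+* Γ(V, ⊤)}

lemma isTautologicalPullback_of_frames
    (hτ : ∀ (U : V.Opens) (m : ∀ a, Γ(E a, U)) (hm : ∀ a, IsBasis (E a) (m a))
      (y : invariants I), restrictFunctions U (τ y) = frameEvalQ Φ hm y) :
    IsTautologicalPullback Φ τ := by
  intro U t f hf
  rw [hτ U _ fun a => isBasis_trivBasis (t a)]
  change MvPolynomial.eval₂ _ _ f = _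
  congr 1
  funext e
  exact IsBasis.coord_eq _ (coordinate_smul _ _ _)

lemma IsTautologicalPullback.unique [Finite Q] (hE : ∀ a, IsLineBundle (E a))
    (hτ : IsTautologicalPullback Φ τ) {τ' : invariants I →+* Γ(V, ⊤)}
    (hτ' : IsTautologicalPullback Φ τ') : τ' = τ := by
  refine RingHom.ext fun y => function_ext fun x _ => ?_
  obtain ⟨U, m, hx, hm⟩ := exists_frame hE x
  refine ⟨U, le_top, hx, ?_⟩
  obtain ⟨y, hy⟩ := y
  obtain ⟨f, rfl⟩ := Ideal.Quotient.mk_surjective y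
  exact (hτ' U (fun a => (hm a).triv) f hy).trans (hτ U (fun a => (hm a).triv) f hy).symm

end Frames

/-! ### Completing arrows to closed walks. -/

section BalancedSubalgebra

variable {k : Type u} [Field k] {Q : Type} [Quiver.{u} Q]

/-- If the products of the elements attached to the nodes and the arrows along closed walks through
a base point lie in a subalgebra, then every balanced polynomial in the arrows is a fraction of
elements of that subalgebra. -/
lemma exists_pow_mul_aeval_mem [Fintype Q] {A : Type*} [CommRing A] [Algebra k A]
    (S : Subalgebra k A) (x : (Σ a b : Q, (a ⟶ b)) → A) (ν μ : Q → A)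
    (h₁ : ∀ a, ν a * μ a ∈ S) (h₂ : ∀ e, ν e.2.1 * x e * μ e.1 ∈ S) {f : ArrowPolynomial k Q}
    (hf : ∀ d ∈ f.support, IsBalanced d) :
    ∃ N : ℕ, (∏ a, ν a * μ a) ^ N * MvPolynomial.aeval x f ∈ S := by
  classical
  set C := ∏ a, ν a * μ a with hC
  have hCS : C ∈ S := Subalgebra.prod_mem _ fun a _ => h₁ a
  have hmono (d : (Σ a b : Q, (a ⟶ b)) →₀ ℕ) (hd : IsBalanced d) :
      ∃ N : ℕ, C ^ N * d.prod (fun e n => x e ^ n) ∈ S := by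
    -- One factor `C` for each arrow of the monomial, counted with multiplicity.
    refine ⟨d.sum fun _ n => n, ?_⟩
    let r (a : Q) : A := ∏ b ∈ Finset.univ.erase a, ν b * μ b
    have hr (a : Q) : C = ν a * μ a * r a :=
      (Finset.mul_prod_erase _ _ (Finset.mem_univ a)).symm
    have hrS (a : Q) : r a ∈ S := Subalgebra.prod_mem _ fun b _ => h₁ b
    have h3 : C ^ (d.sum fun _ n => n) = d.prod fun e n => (ν e.1 * μ e.1 * r e.1) ^ n := by
      simp only [← hr]
      rw [Finsupp.sum, ← Finset.prod_pow_eq_pow_sum]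
      rfl
    have h4 : C ^ (d.sum fun _ n => n) * d.prod (fun e n => x e ^ n) =
        d.prod (fun e n => (ν e.2.1 * x e * μ e.1) ^ n) * d.prod fun e n => r e.1 ^ n := by
      rw [h3]
      simp only [mul_pow, Finsupp.prod_mul]
      -- Balancedness moves the factors `ν` from the sources of the arrows to their targets, where
      -- they close the walks.
      rw [hd.prod_eq ν]
      ring
    rw [h4]
    exact S.mul_mem (Subalgebra.prod_mem _ fun e _ => S.pow_mem (h₂ e) _)
      (Subalgebra.prod_mem _ fun e _ => S.pow_mem (hrS _) _)
  rw [f.as_sum, map_sum]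
  choose! N hN using hmono
  refine ⟨∑ d ∈ f.support, N d, ?_⟩
  rw [Finset.mul_sum]
  refine Subalgebra.sum_mem _ fun d hd => ?_
  rw [MvPolynomial.aeval_monomial, ← Finset.sum_erase_add _ _ hd, pow_add, mul_assoc]
  refine S.mul_mem (S.pow_mem hCS _) ?_
  rw [mul_left_comm]
  exact S.mul_mem (S.algebraMap_mem _) (hN d (hf d hd))

end BalancedSubalgebra

/-! ### Surjectivity and kernel of the tautological pullback. -/

section Kernel

open Quiver

variable {k : Type u} [Field k] {Q : Type} [Quiver.{u} Q] {I : AdmissibleIdeal k Q}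
  {V : Scheme.{u}} [V.Over (Spec (CommRingCat.of k))] {E : Q → V.Modules}
  (Φ : PathAlgebraIso I E)

/-- The functions on the scheme of representations that correspond to endomorphisms of `E_a`. -/
def endSubalgebra (a : Q) : Subalgebra k (RepresentationRing I) where
  carrier := Set.range (bfun Φ a a)
  mul_mem' := by
    rintro _ _ ⟨φ, rfl⟩ ⟨ψ, rfl⟩
    exact ⟨φ ≫ ψ, bfun_comp Φ φ ψ⟩
  add_mem' := by
    rintro _ _ ⟨φ, rfl⟩ ⟨ψ, rfl⟩
    exact ⟨φ + ψ, map_add _ _ _⟩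
  algebraMap_mem' c := ⟨c • 𝟙 (E a), by rw [map_smul, bfun_id, Algebra.algebraMap_eq_smul_one]⟩

lemma endSubalgebra_le (a : Q) : endSubalgebra Φ a ≤ invariants I := by
  rintro _ ⟨φ, rfl⟩
  exact bfun_mem_invariants Φ φ

variable {τ : invariants I →+* Γ(V, ⊤)}
  (hτ : ∀ (U : V.Opens) (m : ∀ a, Γ(E a, U)) (hm : ∀ a, IsBasis (E a) (m a))
    (y : invariants I), restrictFunctions U (τ y) = frameEvalQ Φ hm y)
  (hE : ∀ a, IsLineBundle (E a))
include hτ hE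

/-- Multiplication by `r` on `E_a` gives an invariant whose value in every frame is `r`. -/
lemma tautologicalPullback_surjective [Finite Q] [Nonempty Q] : Function.Surjective τ := by
  intro r
  let a : Q := Classical.arbitrary Q
  refine ⟨⟨bfun Φ a a (r • 𝟙 (E a)), bfun_mem_invariants Φ _⟩, function_ext fun x _ => ?_⟩
  obtain ⟨U, m, hx, hm⟩ := exists_frame hE x
  refine ⟨U, le_top, hx, (hτ U m hm _).trans ?_⟩
  apply (hm a).smul_injective
  rw [frameEvalQ_bfun]
  exact smulHom_app r (𝟙 (E a)) U (m a)

/-- In every frame `ψ` is multiplication by the pulled back function. -/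
lemma eq_zero_of_tautologicalPullback_eq_zero [Finite Q] {a : Q} (ψ : E a ⟶ E a)
    (h : τ ⟨bfun Φ a a ψ, bfun_mem_invariants Φ ψ⟩ = 0) : ψ = 0 := by
  refine hom_ext_of_basis fun x => ?_
  obtain ⟨U, m, hx, hm⟩ := exists_frame hE x
  refine ⟨U, m a, hx, hm a, ?_⟩
  have h1 := hτ U m hm ⟨bfun Φ a a ψ, bfun_mem_invariants Φ ψ⟩
  rw [h, map_zero] at h1
  rw [← frameEvalQ_bfun Φ hm ψ, ← h1, zero_smul]
  rfl

/-- The kernel of the pullback of invariant functions is killed by powers of a function with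
non-zero pullback. -/
lemma exists_pow_mul_eq_zero [Infinite k] [Finite Q] [Nonempty Q] [IsIntegral V] [CompactSpace V]
    (hV : HasGlobalFractions V) :
    ∃ c : invariants I, τ c ≠ 0 ∧ ∀ y, τ y = 0 → ∃ N : ℕ, c ^ N * y = 0 := by
  have := Fintype.ofFinite Q
  let a₀ : Q := Classical.arbitrary Q
  obtain ⟨U, m, hx, hm⟩ := exists_frame hE (Classical.arbitrary V)
  have hU : (U : Set V).Nonempty := ⟨_, hx⟩
  choose ν c hc hν using fun a => hV.exists_hom (hE a₀) (hE a) (hm a₀) (hm a) hU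
  choose μ c' hc' hμ using fun a => hV.exists_hom (hE a) (hE a₀) (hm a) (hm a₀) hU
  have hmem (a : Q) : bfun Φ a a₀ (ν a) * bfun Φ a₀ a (μ a) ∈ endSubalgebra Φ a₀ :=
    ⟨ν a ≫ μ a, bfun_comp Φ _ _⟩
  have hCmem : ∏ a, bfun Φ a a₀ (ν a) * bfun Φ a₀ a (μ a) ∈ invariants I :=
    Subalgebra.prod_mem _ fun a _ => endSubalgebra_le Φ a₀ (hmem a)
  refine ⟨⟨_, hCmem⟩, fun h0 => ?_, ?_⟩
  · have h1 := hτ U m hm ⟨_, hCmem⟩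
    have h2 (a) : frameEvalQ Φ hm (bfun Φ a a₀ (ν a)) = fres le_top (c a) := by
      apply (hm a).smul_injective
      rw [frameEvalQ_bfun, hν]
    have h3 (a) : frameEvalQ Φ hm (bfun Φ a₀ a (μ a)) = fres le_top (c' a) := by
      apply (hm a₀).smul_injective
      rw [frameEvalQ_bfun, hμ]
    simp only [map_prod, map_mul, h2, h3] at h1
    simp only [← map_mul, ← map_prod] at h1
    rw [h0] at h1
    have h4 := fres_injective (le_top : U ≤ ⊤) hU h1
    exact Finset.prod_ne_zero_iff.2 (fun a _ => mul_ne_zero (hc a) (hc' a)) h4.symm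
  · rintro ⟨y, hy⟩ hy0
    obtain ⟨f, rfl⟩ := Ideal.Quotient.mk_surjective y
    obtain ⟨f₀, hf₀, hf⟩ := exists_balanced hy
    -- The walk for an arrow is the composite `E_{a₀} ⟶ E_b ⟶ E_a ⟶ E_{a₀}`, so a power of `c` times
    -- the invariant comes from one endomorphism `ψ`.
    obtain ⟨N, ψ, hN⟩ := exists_pow_mul_aeval_mem (endSubalgebra Φ a₀)
      (fun e => bfun Φ e.1 e.2.1 (Φ.arrow e.2.2)) (fun a => bfun Φ a a₀ (ν a))
      (fun a => bfun Φ a₀ a (μ a)) hmem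
      (fun e => ⟨ν e.2.1 ≫ Φ.arrow e.2.2 ≫ μ e.1, by
        rw [bfun_comp, bfun_comp, mul_assoc]⟩) hf₀
    have h1 : MvPolynomial.aeval (fun e => bfun Φ e.1 e.2.1 (Φ.arrow e.2.2)) f₀ =
        Ideal.Quotient.mk (representationIdeal I) f₀ := by
      refine AlgHom.congr_fun (φ₂ := Ideal.Quotient.mkₐ k (representationIdeal I)) ?_ f₀
      refine MvPolynomial.algHom_ext fun e => ?_
      rw [MvPolynomial.aeval_X, bfun_arrow]
      rfl
    rw [h1, hf] at hN
    refine ⟨N, Subtype.ext ?_⟩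
    refine hN.symm.trans ?_
    rw [eq_zero_of_tautologicalPullback_eq_zero Φ hτ hE ψ, map_zero]
    · rfl
    · have : (⟨bfun Φ a₀ a₀ ψ, bfun_mem_invariants Φ ψ⟩ : invariants I) =
          ⟨_, hCmem⟩ ^ N * ⟨_, hy⟩ := Subtype.ext hN
      rw [this, map_mul, hy0, mul_zero]

end Kernel

/-! ### Closed immersions onto irreducible components. -/

section IrreducibleComponents

variable {M Y : Scheme.{u}} [IsIntegral Y] (f : Y ⟶ M) [IsClosedImmersion f] {D : M.Opens}
  (hD : (D : Set M) ⊆ Set.range f) (hD' : (D : Set M).Nonempty)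
include hD

omit [IsIntegral Y] in
lemma subset_range_of_isIrreducible {T : Set M} (hT : IsIrreducible T)
    (h : (T ∩ (D : Set M)).Nonempty) : T ⊆ Set.range f := by
  refine (subset_closure_inter_of_isPreirreducible_of_isOpen hT.2 D.2 h).trans ?_
  exact closure_minimal (Set.inter_subset_right.trans hD) f.isClosedEmbedding.isClosed_range

include hD'

/-- The image of a closed immersion of an integral scheme that contains a non-empty open set is
an irreducible component. -/
lemma range_mem_irreducibleComponents : Set.range f ∈ irreducibleComponents M := by
  refine ⟨?_, fun T hT hfT => subset_range_of_isIrreducible f hD hT ?_⟩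
  · rw [← Set.image_univ]
    exact (IrreducibleSpace.isIrreducible_univ Y).image f f.continuous.continuousOn
  · obtain ⟨x, hx⟩ := hD'
    exact ⟨x, hfT (hD hx), hx⟩

/-- An irreducible component that meets `D` lies in the range of `f`, hence equals it; so the open
`D` avoids the closure of the union of the others. -/
lemma le_componentOpen : D ≤ componentOpen (Set.range f) := by
  refine Set.subset_compl_comm.1 (closure_minimal (Set.sUnion_subset fun T hT x hxT hxD => ?_)
    D.2.isClosed_compl)
  have h : T ⊆ Set.range f := subset_range_of_isIrreducible f hD hT.1.1 ⟨x, hxT, hxD⟩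
  exact hT.2 (subset_antisymm h
    (hT.1.2 (range_mem_irreducibleComponents f hD hD').1 h))

omit hD hD' [IsIntegral Y] [IsClosedImmersion f] in
lemma componentOpen_subset (Z : Set M) : (componentOpen Z : Set M) ⊆ Z := by
  intro x hx
  by_contra hxZ
  refine hx (subset_closure ⟨irreducibleComponent x, ⟨irreducibleComponent_mem_irreducibleComponents x,
    fun h => hxZ (h ▸ mem_irreducibleComponent)⟩, mem_irreducibleComponent⟩)

omit hD hD' in
-- The kernel of `f` is radical because `Y` is reduced, and its support is the closed range of `f`.
lemma reducedComponentIdeal_range (hZ : Set.range f ∈ irreducibleComponents M) :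
    reducedComponentIdeal (Set.range f) hZ = f.ker := by
  have h1 : (⟨Set.range f, isClosed_of_mem_irreducibleComponents _ hZ⟩ : Closeds M) =
      f.ker.support := by
    refine Closeds.ext ?_
    rw [Scheme.Hom.support_ker]
    exact f.isClosedEmbedding.isClosed_range.closure_eq.symm
  rw [reducedComponentIdeal, h1, Scheme.IdealSheafData.vanishingIdeal_support]
  refine Scheme.IdealSheafData.ext (funext fun U => ?_)
  rw [Scheme.IdealSheafData.radical_ideal, Scheme.Hom.ker_apply]
  refine Ideal.IsRadical.radical fun x ⟨n, hx⟩ => ?_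
  rw [RingHom.mem_ker, map_pow] at hx
  exact IsReduced.eq_zero _ ⟨n, hx⟩

lemma componentIdeal_range [IsReduced M] : componentIdeal (Set.range f) = f.ker := by
  have hle := le_componentOpen f hD hD'
  apply le_antisymm
  -- A function that vanishes on the component's open part pulls back to zero on a non-empty open
  -- subset of the integral `Y`, hence everywhere.
  · intro W a ha
    have h1 := (componentOpen (Set.range f)).ι.ideal_ker_le W ha
    rw [RingHom.mem_ker, Scheme.Opens.ι_app] at h1
    rw [Scheme.Hom.ker_apply, RingHom.mem_ker]
    let W' := (componentOpen (Set.range f)).ι ''ᵁ ((componentOpen (Set.range f)).ι ⁻¹ᵁ W)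
    have hW' : W' ≤ W := Scheme.Hom.image_preimage_le _ _
    have h2 : fres hW' a = 0 := h1
    have h3 : fres (f.preimage_mono hW') (f.app W a) = 0 := by
      rw [← app_fres f hW', h2, map_zero]
    by_cases hne : (f ⁻¹ᵁ W : Set Y).Nonempty
    · refine fres_injective (f.preimage_mono hW') ?_ (h3.trans (map_zero _).symm)
      have hD2 : (f ⁻¹ᵁ componentOpen (Set.range f) : Set Y).Nonempty := by
        obtain ⟨x, hx⟩ := hD'
        obtain ⟨y, rfl⟩ := hD hx
        exact ⟨y, hle hx⟩
      obtain ⟨y, hy1, hy2⟩ := inf_nonempty hD2 hne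
      exact ⟨y, ⟨f y, hy1⟩, hy2, rfl⟩
    · have := (Opens.not_nonempty_iff_eq_bot _).1 hne
      exact function_ext fun x hx => (hne ⟨x, hx⟩).elim
  -- A function that vanishes on `Y` vanishes at all points of the range, which contains the
  -- component's open part; as `M` is reduced, it restricts to zero there.
  · refine Scheme.IdealSheafData.le_ofIdeals_iff.2 fun W a ha => ?_
    rw [Scheme.Hom.ker_apply, RingHom.mem_ker] at ha
    rw [RingHom.mem_ker, ← basicOpen_eq_bot_iff, ← Scheme.preimage_basicOpen, eq_bot_iff]
    intro x hx
    obtain ⟨y, hy⟩ := componentOpen_subset _ x.2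
    have h1 : f y ∈ M.basicOpen a := by
      rw [hy]
      exact hx
    have h2 : y ∈ f ⁻¹ᵁ M.basicOpen a := h1
    rw [Scheme.preimage_basicOpen, ha, Scheme.basicOpen_zero] at h2
    exact h2.elim

omit [IsIntegral Y] hD hD' in
lemma exists_iso_subscheme {J : M.IdealSheafData} (hJ : J = f.ker) :
    ∃ e : Y ≅ J.subscheme, e.hom ≫ J.subschemeι = f := by
  subst hJ
  exact ⟨asIso f.toImage, f.toImage_imageι⟩

end IrreducibleComponents

/-! ### The image of the spectrum. -/

section Spec

variable {A R : Type u} [CommRing A] [CommRing R]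

/-- If the kernel of a surjective homomorphism is killed by powers of `c`, the image of the
spectrum contains the open set where `c` does not vanish. -/
lemma basicOpen_subset_range {τ : A →+* R} (hτ : Function.Surjective τ) {c : A}
    (h : ∀ y, τ y = 0 → ∃ N : ℕ, c ^ N * y = 0) :
    (PrimeSpectrum.basicOpen c : Set (PrimeSpectrum A)) ⊆
      Set.range (Spec.map (CommRingCat.ofHom τ)) := by
  refine Set.Subset.trans (fun p hp => ?_) (range_comap_of_surjective _ τ hτ).ge
  intro y hy
  obtain ⟨N, hN⟩ := h y hy
  have h1 : c ^ N * y ∈ p.asIdeal := hN ▸ p.asIdeal.zero_mem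
  exact (p.2.mem_or_mem h1).resolve_left fun h2 => hp (p.2.mem_of_pow_mem N h2)

end Spec

end BondalSpiral

end

/-! ### The main theorem. -/

theorem corollary3 {k : Type u} [Field k] [IsAlgClosed k]
    {X : Scheme.{u}} [X.Over (Spec (CommRingCat.of k))] [IsIntegral X]
    (hsmooth : Smooth (X ↘ Spec (CommRingCat.of k)))
    (hproj : BondalSpiral.IsProjective k X)
    {n : ℕ} (hn : 0 < n) (L : X.Modules) (hL : BondalSpiral.IsAntiAmple L)
    (E : ℤ → X.Modules) (hline : ∀ i ∈ Set.Icc (1 : ℤ) n, BondalSpiral.IsLineBundle (E i))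
    (hspiral : BondalSpiral.IsSimpleSpiral k L n E)
    {V : Scheme.{u}} [V.Over (Spec (CommRingCat.of k))]
    (π : V ⟶ X) [π.IsOver (Spec (CommRingCat.of k))]
    (s : Γ((Scheme.Modules.pullback π).obj L, ⊤)) (hV : BondalSpiral.IsTotalSpace π L s)
    {Q : Type} [Quiver.{u} Q] (I : BondalSpiral.AdmissibleIdeal k Q)
    (node : Q ≃ Set.Icc (1 : ℤ) n)
    (Φ : BondalSpiral.PathAlgebraIso I
      (fun a => (Scheme.Modules.pullback π).obj (E (node a)))) :
    ∃ τ : BondalSpiral.invariants I →+* Γ(V, ⊤),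
      BondalSpiral.IsTautologicalPullback Φ τ ∧
      (∀ τ' : BondalSpiral.invariants I →+* Γ(V, ⊤),
        BondalSpiral.IsTautologicalPullback Φ τ' → τ' = τ) ∧
      ∃ (φ₀ : Spec Γ(V, ⊤) ⟶ BondalSpiral.affineQuotient I),
        φ₀ = Spec.map (CommRingCat.ofHom τ) ∧
        ∃ (Z : Set (BondalSpiral.affineQuotient I)) (hZ : Z ∈ irreducibleComponents _),
          (∃ e : Spec Γ(V, ⊤) ≅ (BondalSpiral.reducedComponentIdeal Z hZ).subscheme,
            e.hom ≫ (BondalSpiral.reducedComponentIdeal Z hZ).subschemeι = φ₀) ∧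
          (IsReduced (BondalSpiral.affineQuotient I) →
            ∃ e : Spec Γ(V, ⊤) ≅ (BondalSpiral.componentIdeal Z).subscheme,
              e.hom ≫ (BondalSpiral.componentIdeal Z).subschemeι = φ₀) := by
  have hXqs : QuasiSeparatedSpace X := hproj.quasiSeparatedSpace
  have hXc : CompactSpace X := by
    obtain ⟨-, L', -, h⟩ := hL
    exact h.2.1
  have hπ : IsAffineHom π := hV.isAffineHom hL.1
  have hVint : IsIntegral V := hV.isIntegral hL.1
  have hVqs : QuasiSeparatedSpace V := quasiSeparatedSpace_of_quasiSeparated π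
  have hVc : CompactSpace V := QuasiCompact.compactSpace_of_compactSpace π
  obtain ⟨g, hg, hg'⟩ := hV.exists_isAffineOpen_basicOpen hL
  have hfrac := BondalSpiral.hasGlobalFractions hg hg'
  have hE (a : Q) : BondalSpiral.IsLineBundle ((Scheme.Modules.pullback π).obj (E (node a))) := by
    intro x
    obtain ⟨U, e, hx, he⟩ := (hline _ (node a).2).exists_isBasis (π x)
    exact ⟨π ⁻¹ᵁ U, hx, ⟨(he.pb π).triv⟩⟩
  have hQfin : Finite Q := Finite.of_equiv _ node.symm
  have hQne : Nonempty Q := ⟨node.symm ⟨1, le_rfl, by exact_mod_cast hn⟩⟩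
  have hk : Infinite k := IsAlgClosed.instInfinite
  obtain ⟨τ, hτ⟩ := BondalSpiral.exists_tautologicalPullback Φ hE
  have hτ' := BondalSpiral.isTautologicalPullback_of_frames Φ hτ
  have hsurj := BondalSpiral.tautologicalPullback_surjective Φ hτ hE
  obtain ⟨c, hc, hker⟩ := BondalSpiral.exists_pow_mul_eq_zero Φ hτ hE hfrac
  let φ₀ : Spec Γ(V, ⊤) ⟶ BondalSpiral.affineQuotient I := Spec.map (CommRingCat.ofHom τ)
  have hclosed : IsClosedImmersion φ₀ := IsClosedImmersion.spec_of_surjective _ hsurj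
  let D : (BondalSpiral.affineQuotient I).Opens := PrimeSpectrum.basicOpen c
  have hD : (D : Set (BondalSpiral.affineQuotient I)) ⊆ Set.range φ₀ :=
    BondalSpiral.basicOpen_subset_range hsurj hker
  have hD' : (D : Set (BondalSpiral.affineQuotient I)).Nonempty :=
    -- The image of the generic point of the domain `Γ(V, ⊤)` lies in `D` because `τ c ≠ 0`.
    ⟨φ₀ (⟨⊥, Ideal.isPrime_bot⟩ : PrimeSpectrum Γ(V, ⊤)), fun h => hc h⟩
  have hZ := BondalSpiral.range_mem_irreducibleComponents φ₀ hD hD'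
  exact ⟨τ, hτ', fun τ' h => hτ'.unique Φ hE h, φ₀, rfl, Set.range φ₀, hZ,
    BondalSpiral.exists_iso_subscheme φ₀ (BondalSpiral.reducedComponentIdeal_range φ₀ hZ),
    fun _ => BondalSpiral.exists_iso_subscheme φ₀ (BondalSpiral.componentIdeal_range φ₀ hD hD')⟩
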